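/- Let $n\ge 1$ and consider $n^2$ cards placed in the positions $(r,s)$, $1\le r,s\le n$, of an $n\times n$ array, with $(1,1)$ in the upper-left corner. For $1\le i,j\le n$ let $\pi_{ij}$ be the permutation of the positions which sends $(r,s)$ to $(i+1-r,\,j+1-s)$ if $r\le i$ and $s\le j$ and fixes $(r,s)$ otherwise (the upper-left $i\times j$ rectangle is rotated by $180^\circ$), and let $\pi'_{ij}$ be the permutation which sends $(r,s)$ to $(n+i-r,\,n+j-s)$ if $r\ge i$ and $s\ge j$ and fixes $(r,s)$ otherwise (rotation of a lower-right rectangle). Let $\mathcal S$ be the probability measure on the group of permutations of the positions that chooses each of the $2n^2$ shuffles $\pi_{ij}$, $\pi'_{ij}$ with probability $1/(2n^2)$ (adding the probabilities of shuffles that coincide), let $\mathcal S^{(m)}$ be its $m$-fold convolution power, and for $t\ge 0$ let $$\mathcal S^t=\sum_{m\ge 0}e^{-t}\frac{t^m}{m!}\,\mathcal S^{(m)}$$ be the distribution at time $t$ of the continuous-time shuffle in which each $\pi_{ij}$ and each $\pi'_{ij}$ occurs at rate $1/(2n^2)$. Let $U$ be the uniform distribution on permutations of the positions. For a distribution $\mathcal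 R$ on permutations of the positions and $k \le n^2$, let $\|\mathcal R-U\|_k$ be the supremum of $\mathcal R(A)-U(A)$ over all events of the form $A=\{\pi:(\pi(x_1),\dots,\pi(x_k))\in B\}$, where $x_1,\dots,x_k$ are distinct cards (identified with their initial positions) and $B$ is a set of $k$-tuples of distinct positions. **Theorem.** There is a universal constant $c>0$ such that for all integers $n,k$ with $1<k<n$, all integers $j\ge 0$ and all real $t$, $$\|\mathcal S^t-U\|_k<2^{-j}\qquad\text{whenever}\qquad t>c\,k^3(\ln k)^2\,n\,j .$$ In particular any fixed number of cards is randomized in time $O(n)$: for every integer $k\ge 1$ there is a constant $C_k>0$ such that for all $n>k$, all integers $j\ge 0$ and all real $t>C_k\,n\,j$ one has $\|\mathcal S^t-U\|_k<2^{-j}$. -/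

import Mathlib

open scoped Nat

noncomputable section

namespace ArrayShuffle

/-- The positions of the `n × n` array, rows and columns numbered `0, …, n - 1` from the
upper-left corner. Cards are identified with their initial positions, and a configuration is the
permutation that sends each card to its current position. -/
abbrev Pos (n : ℕ) : Type := Fin n × Fin n

/-- Reversal of the initial segment `{0, …, i}`: `r ↦ i - r`. -/
def flipLow {n : ℕ} (i r : Fin n) (_h : r ≤ i) : Fin n :=
  ⟨i.val - r.val, by omega⟩

/-- Reversal of the final segment `{i, …, n - 1}`: `r ↦ (n - 1) + i - r`. -/
def flipHigh {n : ℕ} (i r : Fin n) (h : i ≤ r) : Fin n :=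
  ⟨(n - 1) + i.val - r.val, by
    have := Fin.le_def.mp h
    omega⟩

/-- The effect on positions of rotating by 180 degrees the rectangle of rows `0, …, i` and
columns `0, …, j`. -/
def upperLeftFun {n : ℕ} (i j : Fin n) (p : Pos n) : Pos n :=
  if h : p.1 ≤ i ∧ p.2 ≤ j then (flipLow i p.1 h.1, flipLow j p.2 h.2) else p

/-- The effect on positions of rotating by 180 degrees the rectangle of rows `i, …, n - 1` and
columns `j, …, n - 1`. -/
def lowerRightFun {n : ℕ} (i j : Fin n) (p : Pos n) : Pos n :=
  if h : i ≤ p.1 ∧ j ≤ p.2 then (flipHigh i p.1 h.1, flipHigh j p.2 h.2) else p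

theorem upperLeftFun_involutive {n : ℕ} (i j : Fin n) :
    Function.Involutive (upperLeftFun i j) := by
  rintro ⟨r, s⟩
  by_cases h : r ≤ i ∧ s ≤ j
  · obtain ⟨h1, h2⟩ := h
    have h3 := Fin.le_def.mp h1
    have h4 := Fin.le_def.mp h2
    simp only [upperLeftFun, flipLow, h1, h2, and_self, dite_true, Fin.le_def, Nat.sub_le]
    ext <;> simp <;> omega
  · simp [upperLeftFun, h]

theorem lowerRightFun_involutive {n : ℕ} (i j : Fin n) :
    Function.Involutive (lowerRightFun i j) := by
  rintro ⟨r, s⟩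
  by_cases h : i ≤ r ∧ j ≤ s
  · obtain ⟨h1, h2⟩ := h
    have h3 := Fin.le_def.mp h1
    have h4 := Fin.le_def.mp h2
    have h5 : i.val ≤ n - 1 + i.val - r.val := by omega
    have h6 : j.val ≤ n - 1 + j.val - s.val := by omega
    simp only [lowerRightFun, flipHigh, h1, h2, and_self, dite_true, Fin.le_def, h5, h6]
    ext <;> simp <;> omega
  · simp [lowerRightFun, h]

/-- The permutation `π_ij`: the upper-left rectangle with lower-right corner `(i, j)` is rotated
by 180 degrees, all other cards stay. -/
def rotUL {n : ℕ} (i j : Fin n) : Equiv.Perm (Pos n) :=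
  (upperLeftFun_involutive i j).toPerm

/-- The permutation `π'_ij`: the lower-right rectangle with upper-left corner `(i, j)` is rotated
by 180 degrees, all other cards stay. -/
def rotLR {n : ℕ} (i j : Fin n) : Equiv.Perm (Pos n) :=
  (lowerRightFun_involutive i j).toPerm

/-- The distribution `S` of one step, as a mass function on the permutations: each `π_ij` and each
`π'_ij` is chosen with probability `1 / (2 n²)`. -/
def step (n : ℕ) (g : Equiv.Perm (Pos n)) : ℝ :=
  ∑ i : Fin n, ∑ j : Fin n,
    (1 / (2 * (n : ℝ) ^ 2)) *
      ((if rotUL i j = g then 1 else 0) + (if rotLR i j = g then 1 else 0))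

/-- Convolution of two mass functions on a finite group: the law of a product of independent
elements with laws `μ` and `ν`. -/
def conv {G : Type*} [Group G] [Fintype G] (μ ν : G → ℝ) (g : G) : ℝ :=
  ∑ h : G, μ h * ν (h⁻¹ * g)

open Classical in
/-- The `m`-fold convolution power; the zeroth is the point mass at the identity. -/
def convPow {G : Type*} [Group G] [Fintype G] (μ : G → ℝ) : ℕ → G → ℝ
  | 0 => fun g => if g = 1 then 1 else 0
  | m + 1 => conv (convPow μ m) μ

/-- The distribution `S^t = ∑ₘ e^{-t} (t^m / m!) S^{(m)}` of the continuous-time shuffle at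
time `t`, as a mass function. -/
def shuffleAt (n : ℕ) (t : ℝ) (g : Equiv.Perm (Pos n)) : ℝ :=
  ∑' m : ℕ, Real.exp (-t) * (t ^ m / (m ! : ℝ)) * convPow (step n) m g

/-- The uniform distribution on the permutations of the array. -/
def uniform (n : ℕ) (_g : Equiv.Perm (Pos n)) : ℝ :=
  1 / (Fintype.card (Equiv.Perm (Pos n)) : ℝ)

open Classical in
/-- The mass that `R` gives to the event `A`. -/
def mass {G : Type*} [Fintype G] (R : G → ℝ) (A : Set G) : ℝ :=
  ∑ g : G, if g ∈ A then R g else 0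

/-- The event that the positions of the cards `x 0, …, x (k - 1)` form a tuple in `B`, for `B` a
set of `k`-tuples of distinct positions. -/
def cardEvent {n k : ℕ} (x : Fin k ↪ Pos n) (B : Set (Fin k ↪ Pos n)) :
    Set (Equiv.Perm (Pos n)) :=
  {g | x.trans g.toEmbedding ∈ B}

/-- The `k`-set distance to uniformity of `R`: the supremum of `R(A) - U(A)` over the events `A`
that depend only on the positions of some `k` distinct cards. -/
def kSetDist (n k : ℕ) (R : Equiv.Perm (Pos n) → ℝ) : ℝ :=
  ⨆ p : (Fin k ↪ Pos n) × Set (Fin k ↪ Pos n),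
    mass R (cardEvent p.1 p.2) - mass (uniform n) (cardEvent p.1 p.2)

end ArrayShuffle

end

/-!
The distance to uniformity is bounded by coupling, first for the discrete-time walk: `Close n k m d`
says that after `m` steps the laws of a `k`-tuple of cards started from any two tuples are within
`d` in total variation. This quantity is submultiplicative in time (`Close.pow`), so it suffices to
make it at most `1 / 2` for some `m` of order `k ^ 3 (log k) ^ 2 n`; Poisson weights then give the
continuous-time statement.

*Coupling.* Any two tuples are joined by `2 k` changes of a single card, so it is enough to treat
tuples `x`, `y` with `x b = y b` for `b ≠ a`. As long as both walks use the same rotations, this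
property persists. If at some moment a rectangle in the upper-left corner contains both versions of
card `a` but no other card, then rotations of its upper-left subrectangles affect only card `a`, and
they can be paired in such a way that the two versions end in the same place
(`contracts_one`). With a rectangle of area `n ^ 2 / k` this has probability of order `1 / k`, and
in equilibrium a configuration is of this kind with probability of order `k⁻²`. The latter
involves only three cards at a time, by a union bound over the other cards
(`Close.le_expect_good`). Hence, once three cards are known to mix in time `O(n)`, up to an error
`k⁻³` in time `O(n log k)`, each period of length `O(n log k)` leads to agreement with probability
of order `k⁻³`, and `O(k ^ 3 log k)` periods reduce the distance for a single change below
`1 / (4 k)`.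

*Three cards.* Here a coupling probability bounded below is enough. For two cards at distance `d`,
the number of rotations that cover exactly one of them is at least of order `n d`, and these
rotations lead to distinct displacements. Hence a potential which is of order `n / d` for close
pairs decreases on average while some pair is close, and bounded terms for pairs that nearly share
a row or a column can be added. The slow corners of the array, where a card is rarely moved, are
treated in the same way by two additional points just outside them, from which a card is separated
exactly by the rotations that move it. So after a time of order `n` the cards are spread out with
probability at least `1 / 2` (`exists_expect_spread`). From a spread-out configuration four
rotations, each from a set of probability bounded below, reverse initial segments of the rows so as
to bring the two versions of card `a` above the other two cards (`contractsFrom_room`), where they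
can be coupled.

*Small arrays.* The estimates above need `n` large. For the remaining `n` it is enough that the
walk is irreducible and aperiodic: conjugating `π_12` and `π_21` by `π_ij` gives all transpositions
of neighbouring positions (`reach_eq_top`), and `π_11` is the identity.
-/

noncomputable section

namespace ArrayShuffle

/-! ### The walk in discrete time -/

section

/-- The mean of `F` after one step of the shuffle. -/
def avg (n : ℕ) (F : Equiv.Perm (Pos n) → ℝ) : ℝ :=
  1 / (2 * (n : ℝ) ^ 2) * ∑ i : Fin n, ∑ j : Fin n, (F (rotUL i j) + F (rotLR i j))

/-- The mean of `F` after `m` steps of the shuffle. -/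
def expect (n m : ℕ) (F : Equiv.Perm (Pos n) → ℝ) : ℝ :=
  ∑ g, convPow (step n) m g * F g

variable {n : ℕ}

theorem sum_step_mul (F : Equiv.Perm (Pos n) → ℝ) : ∑ g, step n g * F g = avg n F := by
  simp only [step, avg, Finset.sum_mul, Finset.mul_sum]
  rw [Finset.sum_comm]
  refine Finset.sum_congr rfl fun i _ => ?_
  rw [Finset.sum_comm]
  refine Finset.sum_congr rfl fun j _ => ?_
  simp [mul_add, add_mul, Finset.sum_add_distrib]

theorem step_nonneg (g : Equiv.Perm (Pos n)) : 0 ≤ step n g := by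
  unfold step
  positivity

theorem convPow_nonneg (m : ℕ) (g : Equiv.Perm (Pos n)) : 0 ≤ convPow (step n) m g := by
  induction m generalizing g with
  | zero => simp only [convPow]; positivity
  | succ m ih =>
    exact Finset.sum_nonneg fun h _ => mul_nonneg (ih h) (step_nonneg _)

theorem expect_zero (F : Equiv.Perm (Pos n) → ℝ) : expect n 0 F = F 1 := by
  simp [expect, convPow]

theorem expect_succ (m : ℕ) (F : Equiv.Perm (Pos n) → ℝ) :
    expect n (m + 1) F = expect n m fun h => avg n fun s => F (h * s) := by
  simp only [expect, convPow, conv, Finset.sum_mul]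
  rw [Finset.sum_comm]
  refine Finset.sum_congr rfl fun h _ => ?_
  rw [← sum_step_mul, Finset.mul_sum, ← Equiv.sum_comp (Equiv.mulLeft h)]
  simp [mul_assoc]

theorem expect_sum {ι : Type*} (s : Finset ι) (m : ℕ) (F : ι → Equiv.Perm (Pos n) → ℝ) :
    (expect n m fun g => ∑ i ∈ s, F i g) = ∑ i ∈ s, expect n m (F i) := by
  simp only [expect, Finset.mul_sum]
  rw [Finset.sum_comm]

theorem expect_add_fun (m : ℕ) (F G : Equiv.Perm (Pos n) → ℝ) :
    (expect n m fun g => F g + G g) = expect n m F + expect n m G := by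
  simp [expect, mul_add, Finset.sum_add_distrib]

theorem expect_sub_fun (m : ℕ) (F G : Equiv.Perm (Pos n) → ℝ) :
    (expect n m fun g => F g - G g) = expect n m F - expect n m G := by
  simp [expect, mul_sub, Finset.sum_sub_distrib]

theorem expect_const_mul (m : ℕ) (c : ℝ) (F : Equiv.Perm (Pos n) → ℝ) :
    (expect n m fun g => c * F g) = c * expect n m F := by
  simp only [expect, Finset.mul_sum]
  exact Finset.sum_congr rfl fun g _ => by ring

theorem expect_avg (m : ℕ) (F : Equiv.Perm (Pos n) → Equiv.Perm (Pos n) → ℝ) :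
    (expect n m fun h => avg n fun s => F h s) = avg n fun s => expect n m fun h => F h s := by
  simp only [avg, expect_const_mul, expect_sum, expect_add_fun]

theorem expect_mono (m : ℕ) {F G : Equiv.Perm (Pos n) → ℝ} (h : ∀ g, F g ≤ G g) :
    expect n m F ≤ expect n m G :=
  Finset.sum_le_sum fun g _ => mul_le_mul_of_nonneg_left (h g) (convPow_nonneg m g)

theorem avg_const (hn : 0 < n) (c : ℝ) : (avg n fun _ => c) = c := by
  have : (n : ℝ) ≠ 0 := by positivity
  simp [avg]
  field_simp
  ring

theorem expect_const (hn : 0 < n) (m : ℕ) (c : ℝ) : (expect n m fun _ => c) = c := by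
  induction m with
  | zero => simp [expect_zero]
  | succ m ih => rw [expect_succ]; simp only [avg_const hn, ih]

/-- The Markov property: the first `l` steps give `h`, the next `m` steps give `g`. -/
theorem expect_add (m l : ℕ) (F : Equiv.Perm (Pos n) → ℝ) :
    expect n (m + l) F = expect n l fun h => expect n m fun g => F (g * h) := by
  induction l generalizing F with
  | zero => simp [expect_zero]
  | succ l ih =>
    rw [← add_assoc, expect_succ, ih, expect_succ]
    simp only [expect_avg, mul_assoc]

theorem expect_one (F : Equiv.Perm (Pos n) → ℝ) : expect n 1 F = avg n F := by
  rw [show (1 : ℕ) = 0 + 1 from rfl, expect_succ, expect_zero]; simp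

theorem expect_le_const (hn : 0 < n) (m : ℕ) {F : Equiv.Perm (Pos n) → ℝ} {c : ℝ}
    (h : ∀ g, F g ≤ c) : expect n m F ≤ c :=
  (expect_mono m h).trans_eq (expect_const hn m c)

theorem const_le_expect (hn : 0 < n) (m : ℕ) {F : Equiv.Perm (Pos n) → ℝ} {c : ℝ}
    (h : ∀ g, c ≤ F g) : c ≤ expect n m F :=
  (expect_const hn m c).symm.trans_le (expect_mono m h)

/-- A drift inequality: if `V` changes on average by at most `c - a g` in one step from `g`,
then the means of `a` along the walk are bounded by the total of `c` and the initial value. -/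
theorem sum_expect_le_of_drift (hn : 0 < n) {V a : Equiv.Perm (Pos n) → ℝ} {c : ℝ}
    (hV : ∀ g, 0 ≤ V g) (h : ∀ g, (avg n fun s => V (s * g)) ≤ V g + c - a g) (m : ℕ) :
    ∑ l ∈ Finset.range m, expect n l a ≤ V 1 + m * c := by
  have key : ∀ m : ℕ, expect n m V + ∑ l ∈ Finset.range m, expect n l a ≤ V 1 + m * c := by
    intro m
    induction m with
    | zero => simp [expect_zero]
    | succ m ih =>
      rw [Finset.sum_range_succ, add_comm m 1, expect_add]
      simp only [expect_one]
      have h1 := expect_mono m h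
      rw [expect_sub_fun, expect_add_fun, expect_const hn] at h1
      push_cast
      linarith
  linarith [key m, const_le_expect hn m hV]

end

/-! ### Total variation distance and coupling -/

section

variable {n k : ℕ}

/-- The positions of the cards `x` after the permutation `g`. -/
def move (g : Equiv.Perm (Pos n)) (x : Fin k ↪ Pos n) : Fin k ↪ Pos n :=
  x.trans g.toEmbedding

@[simp]
theorem move_apply (g : Equiv.Perm (Pos n)) (x : Fin k ↪ Pos n) (a : Fin k) :
    move g x a = g (x a) := rfl

theorem move_mul (g h : Equiv.Perm (Pos n)) (x : Fin k ↪ Pos n) :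
    move (g * h) x = move g (move h x) := rfl

/-- The total variation distance between the laws after `m` steps of the tuples of cards that
start from `x` and from `y` is at most `d`. Events are replaced by `[0, 1]`-valued functions. -/
def Within (m : ℕ) (x y : Fin k ↪ Pos n) (d : ℝ) : Prop :=
  ∀ f : (Fin k ↪ Pos n) → ℝ, (∀ z, 0 ≤ f z) → (∀ z, f z ≤ 1) →
    expect n m (fun g => f (move g x)) - expect n m (fun g => f (move g y)) ≤ d

/-- Two tuples that differ in at most one card. -/
def Adj (x y : Fin k ↪ Pos n) : Prop := ∃ a, ∀ b, b ≠ a → x b = y b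

/-- `d` bounds the distance after `m` steps for all pairs of tuples that differ in one card. -/
def AdjBound (n k m : ℕ) (d : ℝ) : Prop := ∀ x y : Fin k ↪ Pos n, Adj x y → Within m x y d

/-- Started from `x` and `y`, the two walks can be coupled so that after `r` steps they agree with
probability at least `p` and otherwise still differ in a single card: `r` additional steps reduce
the distance by the factor `1 - p`. -/
def Contracts (r : ℕ) (p : ℝ) (x y : Fin k ↪ Pos n) : Prop :=
  ∀ m d, 0 ≤ d → AdjBound n k m d → Within (m + r) x y ((1 - p) * d)

theorem Adj.move {x y : Fin k ↪ Pos n} (h : Adj x y) (g : Equiv.Perm (Pos n)) :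
    Adj (move g x) (move g y) := by
  obtain ⟨a, ha⟩ := h
  exact ⟨a, fun b hb => by simp [ha b hb]⟩

theorem Within.mono {m : ℕ} {x y : Fin k ↪ Pos n} {d d' : ℝ} (h : Within m x y d) (hd : d ≤ d') :
    Within m x y d' := fun f h0 h1 => (h f h0 h1).trans hd

theorem Within.add (hn : 0 < n) {m : ℕ} {x y : Fin k ↪ Pos n} {d : ℝ} (h : Within m x y d)
    (l : ℕ) : Within (m + l) x y d := by
  intro f h0 h1
  have key := h (fun z => expect n l fun g => f (ArrayShuffle.move g z))
    (fun z => const_le_expect hn l fun g => h0 _) (fun z => expect_le_const hn l fun g => h1 _)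
  rw [add_comm, expect_add, expect_add]
  exact key

theorem Within.le (hn : 0 < n) {m m' : ℕ} {x y : Fin k ↪ Pos n} {d : ℝ} (h : Within m x y d)
    (hm : m ≤ m') : Within m' x y d := by
  obtain ⟨l, rfl⟩ := Nat.exists_eq_add_of_le hm
  exact h.add hn l

theorem AdjBound.add (hn : 0 < n) {m : ℕ} {d : ℝ} (h : AdjBound n k m d) (l : ℕ) :
    AdjBound n k (m + l) d := fun x y hxy => (h x y hxy).add hn l

theorem Contracts.le (hn : 0 < n) {r r' : ℕ} {p : ℝ} {x y : Fin k ↪ Pos n}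
    (h : Contracts r p x y) (hr : r ≤ r') : Contracts r' p x y := fun m d h0 hd =>
  (h m d h0 hd).le hn (by omega)

theorem Contracts.mono {r : ℕ} {p p' : ℝ} {x y : Fin k ↪ Pos n}
    (h : Contracts r p x y) (hp : p' ≤ p) : Contracts r p' x y := fun m d h0 hd =>
  (h m d h0 hd).mono (mul_le_mul_of_nonneg_right (by linarith) h0)

theorem within_self (m : ℕ) (x : Fin k ↪ Pos n) {d : ℝ} (hd : 0 ≤ d) : Within m x x d :=
  fun f _ _ => by simpa using hd

theorem contracts_self (r : ℕ) {p : ℝ} (hp : p ≤ 1) (x : Fin k ↪ Pos n) : Contracts r p x x :=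
  fun _ _ h0 _ => within_self _ _ (mul_nonneg (by linarith) h0)

/-- If after `l` identical steps the two walks are, with probability at least `q`, in a state from
which they contract, then they contract from the start. -/
theorem Contracts.of_expect (hn : 0 < n) {x y : Fin k ↪ Pos n} (hxy : Adj x y) {l r : ℕ} {p q : ℝ}
    (hp : 0 ≤ p) {S : Set (Equiv.Perm (Pos n))} [DecidablePred (· ∈ S)]
    (hS : ∀ g ∈ S, Contracts r p (move g x) (move g y))
    (hq : q ≤ expect n l fun g => if g ∈ S then 1 else 0) :
    Contracts (r + l) (q * p) x y := by
  intro m d h0 hd f hf0 hf1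
  rw [← add_assoc, expect_add, expect_add, ← expect_sub_fun]
  have h1 : ∀ h : Equiv.Perm (Pos n),
      (expect n (m + r) (fun g => f (move (g * h) x)) -
        expect n (m + r) fun g => f (move (g * h) y)) ≤
        d + -(p * d) * (if h ∈ S then 1 else 0) := by
    intro h
    simp only [move_mul]
    by_cases hS' : h ∈ S
    · have := hS h hS' m d h0 hd f hf0 hf1
      simp only [hS', if_true]
      linarith
    · have := (hd.add hn r) _ _ (hxy.move h) f hf0 hf1
      simp only [hS', if_false]
      linarith
  refine (expect_mono l h1).trans ?_
  rw [expect_add_fun, expect_const hn, expect_const_mul]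
  nlinarith [mul_le_mul_of_nonneg_left hq (mul_nonneg hp h0)]

theorem adjBound_zero (hn : 0 < n) : AdjBound n k 0 1 := by
  intro x y _ f h0 h1
  have h2 := expect_le_const hn 0 fun g => h1 (move g x)
  have h3 := const_le_expect hn 0 fun g => h0 (move g y)
  linarith

theorem AdjBound.pow (hn : 0 < n) {r : ℕ} {p : ℝ} (hp : p ≤ 1)
    (h : ∀ x y : Fin k ↪ Pos n, Adj x y → Contracts r p x y) (j : ℕ) :
    AdjBound n k (j * r) ((1 - p) ^ j) := by
  induction j with
  | zero => simpa using adjBound_zero hn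
  | succ j ih =>
    intro x y hxy
    rw [add_mul, one_mul, pow_succ, mul_comm ((1 - p) ^ j)]
    exact h x y hxy _ _ (pow_nonneg (by linarith) j) ih

/-! ### The coupling step -/

theorem sum_sub_sum_le_of_card_eq {ι : Type*} {F G : ι → ℝ} {d : ℝ} {A B : Finset ι}
    (hcard : A.card = B.card) (h : ∀ v ∈ A, ∀ w ∈ B, F v - G w ≤ d) :
    ∑ v ∈ A, F v - ∑ w ∈ B, G w ≤ A.card * d := by
  rcases B.eq_empty_or_nonempty with rfl | hB
  · have : A = ∅ := by simpa using hcard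
    simp [this]
  obtain ⟨b, hb, hmin⟩ := B.exists_min_image G hB
  have h1 : ∑ v ∈ A, F v ≤ A.card • (G b + d) :=
    Finset.sum_le_card_nsmul _ _ _ fun v hv => by linarith [h v hv b hb]
  have h2 : B.card • G b ≤ ∑ w ∈ B, G w := Finset.card_nsmul_le_sum _ _ _ hmin
  rw [← hcard] at h2
  simp only [nsmul_eq_mul] at h1 h2
  linarith

/-- The rotations `Z` and `Z'` lead to the same states; inside `Q` all other rotations may be paired
arbitrarily, outside `Q` each rotation is paired with itself. -/
theorem sum_sub_sum_le_of_coupling {ι : Type*} [Fintype ι] [DecidableEq ι] {F G : ι → ℝ} {d : ℝ}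
    {Z Z' Q : Finset ι} (hZ : Z ⊆ Q) (hZ' : Z' ⊆ Q) (hsum : ∑ v ∈ Z, F v = ∑ v ∈ Z', G v)
    (hcard : Z.card = Z'.card) (h1 : ∀ v, v ∉ Q → F v - G v ≤ d)
    (h2 : ∀ v ∈ Q, ∀ w ∈ Q, F v - G w ≤ d) :
    ∑ v, F v - ∑ v, G v ≤ (Fintype.card ι - Z.card) * d := by
  have e1 := Finset.sum_add_sum_compl Q F
  have e2 := Finset.sum_add_sum_compl Q G
  have e3 := Finset.sum_sdiff (f := F) hZ
  have e4 := Finset.sum_sdiff (f := G) hZ'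
  have c1 := Finset.card_sdiff_add_card_eq_card hZ
  have c2 := Finset.card_sdiff_add_card_eq_card hZ'
  have c3 := Finset.card_add_card_compl Q
  have h3 : ∑ v ∈ Q \ Z, F v - ∑ v ∈ Q \ Z', G v ≤ (Q \ Z).card * d :=
    sum_sub_sum_le_of_card_eq (by omega) fun v hv w hw =>
      h2 v (Finset.sdiff_subset hv) w (Finset.sdiff_subset hw)
  have h4 : ∑ v ∈ Qᶜ, F v - ∑ v ∈ Qᶜ, G v ≤ Qᶜ.card * d := by
    rw [← Finset.sum_sub_distrib, ← nsmul_eq_mul]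
    exact Finset.sum_le_card_nsmul _ _ _ fun v hv => h1 v (by simpa using hv)
  have c4 : ((Fintype.card ι : ℝ) - Z.card) = (Q \ Z).card + Qᶜ.card := by
    rw [← c3, ← c1]; push_cast; ring
  rw [c4]
  linarith

theorem rotUL_apply_of_le {i j : Fin n} {p : Pos n} (h : p.1 ≤ i ∧ p.2 ≤ j) :
    rotUL i j p = (flipLow i p.1 h.1, flipLow j p.2 h.2) := by
  simp [rotUL, upperLeftFun, h]

theorem rotUL_apply_of_not {i j : Fin n} {p : Pos n} (h : ¬ (p.1 ≤ i ∧ p.2 ≤ j)) :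
    rotUL i j p = p := by
  simp [rotUL, upperLeftFun, h]

theorem rotLR_apply_of_le {i j : Fin n} {p : Pos n} (h : i ≤ p.1 ∧ j ≤ p.2) :
    rotLR i j p = (flipHigh i p.1 h.1, flipHigh j p.2 h.2) := by
  simp [rotLR, lowerRightFun, h]

theorem rotLR_apply_of_not {i j : Fin n} {p : Pos n} (h : ¬ (i ≤ p.1 ∧ j ≤ p.2)) :
    rotLR i j p = p := by
  simp [rotLR, lowerRightFun, h]

/-- The corner `z + t`; rotating the rectangle with this corner sends the card at `z` to `t`. -/
def corner (z : Pos n) {P R : ℕ} (h1 : z.1.val + P ≤ n) (h2 : z.2.val + R ≤ n) :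
    Fin P × Fin R ↪ Fin n × Fin n where
  toFun t := (⟨z.1.val + t.1, by omega⟩, ⟨z.2.val + t.2, by omega⟩)
  inj' := by
    rintro ⟨a, b⟩ ⟨c, d⟩ h
    simp only [Prod.mk.injEq, Fin.mk.injEq] at h
    ext <;> simp <;> omega

theorem corner_fst (z : Pos n) {P R : ℕ} (h1 : z.1.val + P ≤ n) (h2 : z.2.val + R ≤ n)
    (t : Fin P × Fin R) : (corner z h1 h2 t).1.val = z.1.val + t.1 := rfl

theorem corner_snd (z : Pos n) {P R : ℕ} (h1 : z.1.val + P ≤ n) (h2 : z.2.val + R ≤ n)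
    (t : Fin P × Fin R) : (corner z h1 h2 t).2.val = z.2.val + t.2 := rfl

theorem rotUL_corner (z : Pos n) {P R : ℕ} (h1 : z.1.val + P ≤ n) (h2 : z.2.val + R ≤ n)
    (t : Fin P × Fin R) :
    rotUL (corner z h1 h2 t).1 (corner z h1 h2 t).2 z =
      (⟨t.1.val, by omega⟩, ⟨t.2.val, by omega⟩) := by
  have h : z.1 ≤ (corner z h1 h2 t).1 ∧ z.2 ≤ (corner z h1 h2 t).2 :=
    ⟨Fin.le_def.mpr (Nat.le_add_right _ _), Fin.le_def.mpr (Nat.le_add_right _ _)⟩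
  rw [rotUL_apply_of_le h]
  refine Prod.ext (Fin.ext ?_) (Fin.ext ?_) <;> exact Nat.add_sub_cancel_left _ _

/-- If only the differing card lies in the upper-left `A × B` rectangle, in both configurations,
and there is room for `P × R` common targets, then the two walks can be coupled to agree after
one step with probability `P R / (2 n²)`. -/
theorem contracts_one {x y : Fin k ↪ Pos n} {a : Fin k} (hxy : ∀ b, b ≠ a → x b = y b)
    {A B P R : ℕ} (hA : A ≤ n) (hB : B ≤ n)
    (hx : (x a).1.val + P ≤ A ∧ (x a).2.val + R ≤ B)
    (hy : (y a).1.val + P ≤ A ∧ (y a).2.val + R ≤ B)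
    (hw : ∀ b, b ≠ a → ¬ ((x b).1.val < A ∧ (x b).2.val < B)) :
    Contracts 1 (P * R / (2 * (n : ℝ) ^ 2)) x y := by
  intro m d h0 hd f hf0 hf1
  rw [expect_add, expect_add, expect_one, expect_one]
  simp only [move_mul]
  set u : (Fin k ↪ Pos n) → ℝ := fun z => expect n m fun g => f (move g z) with hu
  change avg n (fun s => u (move s x)) - avg n (fun s => u (move s y)) ≤ _
  have hadj : ∀ x' y', Adj x' y' → u x' - u y' ≤ d := fun x' y' h => hd x' y' h f hf0 hf1
  have hn : 0 < n := (x a).1.pos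
  have hn' : (0 : ℝ) < n := by exact_mod_cast hn
  -- The rotations of rectangles inside the `A × B` rectangle move only the card `a`.
  let Q : Finset (Fin n × Fin n) := Finset.univ.filter fun v => v.1.val < A ∧ v.2.val < B
  have hfix : ∀ v ∈ Q, ∀ b, b ≠ a → rotUL v.1 v.2 (x b) = x b := by
    intro v hv b hb
    refine rotUL_apply_of_not fun h => hw b hb ?_
    simp only [Q, Finset.mem_filter, Finset.mem_univ, true_and] at hv
    have := Fin.le_def.mp h.1
    have := Fin.le_def.mp h.2
    omega
  -- `Z` and `Z'` are the rotations that send the two versions of the card `a` to common targets.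
  let Z : Finset (Fin n × Fin n) :=
    Finset.univ.map (corner (x a) (P := P) (R := R) (by omega) (by omega))
  let Z' : Finset (Fin n × Fin n) :=
    Finset.univ.map (corner (y a) (P := P) (R := R) (by omega) (by omega))
  have hUL : ∑ v : Fin n × Fin n, u (move (rotUL v.1 v.2) x) -
      ∑ v : Fin n × Fin n, u (move (rotUL v.1 v.2) y) ≤
        (Fintype.card (Fin n × Fin n) - Z.card) * d := by
    refine sum_sub_sum_le_of_coupling (Z := Z) (Z' := Z') (Q := Q) ?_ ?_ ?_ ?_ ?_ ?_
    · intro v hv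
      simp only [Z, Finset.mem_map, Finset.mem_univ, true_and] at hv
      obtain ⟨t, rfl⟩ := hv
      simp only [Q, Finset.mem_filter, Finset.mem_univ, true_and, corner_fst,
        corner_snd]
      omega
    · intro v hv
      simp only [Z', Finset.mem_map, Finset.mem_univ, true_and] at hv
      obtain ⟨t, rfl⟩ := hv
      simp only [Q, Finset.mem_filter, Finset.mem_univ, true_and, corner_fst,
        corner_snd]
      omega
    · simp only [Z, Z', Finset.sum_map]
      refine Finset.sum_congr rfl fun t _ => congrArg u ?_
      ext1 b
      simp only [move_apply]
      by_cases hb : b = a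
      · rw [hb, rotUL_corner, rotUL_corner]
      · have hmem : ∀ z : Pos n, ∀ (h1 : z.1.val + P ≤ A ∧ z.2.val + R ≤ B),
            corner z (P := P) (R := R) (by omega) (by omega) t ∈ Q := by
          intro z h1
          simp only [Q, Finset.mem_filter, Finset.mem_univ, true_and, corner_fst,
            corner_snd]
          omega
        rw [← hxy b hb, hfix _ (hmem _ hx) b hb, hfix _ (hmem _ hy) b hb]
    · simp [Z, Z']
    · intro v _
      exact hadj _ _ (Adj.move ⟨a, hxy⟩ _)
    · intro v hv w hw'
      refine hadj _ _ ⟨a, fun b hb => ?_⟩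
      simp only [move_apply]
      rw [← hxy b hb, hfix v hv b hb, hfix w hw' b hb]
  have hLR : ∑ v : Fin n × Fin n, u (move (rotLR v.1 v.2) x) -
      ∑ v : Fin n × Fin n, u (move (rotLR v.1 v.2) y) ≤ Fintype.card (Fin n × Fin n) * d := by
    rw [← Finset.sum_sub_distrib]
    refine (Finset.sum_le_card_nsmul _ _ d fun v _ => ?_).trans (by simp)
    exact hadj _ _ (Adj.move ⟨a, hxy⟩ _)
  have hZ : Z.card = P * R := by simp [Z]
  simp only [avg, ← Fintype.sum_prod_type', Finset.sum_add_distrib]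
  rw [hZ] at hUL
  simp only [Fintype.card_prod, Fintype.card_fin] at hUL hLR
  push_cast at hUL hLR
  rw [← mul_sub, one_div, inv_mul_le_iff₀ (by positivity)]
  have : 2 * (n : ℝ) ^ 2 * ((1 - P * R / (2 * (n : ℝ) ^ 2)) * d) =
      (n * n - P * R) * d + n * n * d := by
    field_simp
    ring
  rw [this]
  linarith

end

section

variable {n k : ℕ}

/-! ### From pairs of tuples that differ in one card to all pairs -/

theorem Within.trans {m : ℕ} {x y z : Fin k ↪ Pos n} {d e : ℝ} (h : Within m x y d)
    (h' : Within m y z e) : Within m x z (d + e) := fun f h0 h1 => by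
  linarith [h f h0 h1, h' f h0 h1]

/-- Two tuples without common positions are joined by a path that changes one card at a time. -/
theorem AdjBound.within_of_disjoint {m : ℕ} {d : ℝ} (h : AdjBound n k m d) {x z : Fin k ↪ Pos n}
    (hxz : ∀ a b, x a ≠ z b) : Within m x z (k * d) := by
  -- The hybrid with its first `i` cards from `z` and the others from `x`.
  let hyb : ℕ → (Fin k ↪ Pos n) := fun i =>
    ⟨fun c => if c.val < i then z c else x c, by
      intro a b hab
      by_cases ha : a.val < i <;> by_cases hb : b.val < i <;>
        simp only [ha, hb, if_true, if_false] at hab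
      · exact z.injective hab
      · exact absurd hab.symm (hxz _ _)
      · exact absurd hab (hxz _ _)
      · exact x.injective hab⟩
  have key : ∀ i : ℕ, i ≤ k → Within m x (hyb i) (i * d) := by
    intro i
    induction i with
    | zero =>
      intro _
      have : hyb 0 = x := by ext1 c; simp [hyb]
      rw [this]
      exact within_self _ _ (by simp)
    | succ i ih =>
      intro hi
      have hstep : Within m (hyb i) (hyb (i + 1)) d := by
        refine h _ _ ⟨⟨i, hi⟩, fun b hb => ?_⟩
        have hb' : b.val ≠ i := fun e => hb (Fin.ext e)
        change (if b.val < i then z b else x b) = if b.val < i + 1 then z b else x b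
        simp only [show b.val < i + 1 ↔ b.val < i by omega]
      have := (ih (by omega)).trans hstep
      push_cast
      rwa [add_mul, one_mul]
  have hk : hyb k = z := by ext1 c; simp [hyb]
  simpa [hk] using key k le_rfl

/-- Every pair of tuples is joined, through a tuple disjoint from both, by a path of `2 k` changes
of a single card. -/
theorem AdjBound.within {m : ℕ} {d : ℝ} (h : AdjBound n k m d) (hk : 3 * k ≤ n ^ 2)
    (x y : Fin k ↪ Pos n) : Within m x y (2 * k * d) := by
  classical
  let s : Finset (Pos n) := (Finset.univ.map x ∪ Finset.univ.map y)ᶜ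
  have hs : k ≤ s.card := by
    have h1 := Finset.card_union_le (Finset.univ.map x) (Finset.univ.map y)
    have h2 := Finset.card_add_card_compl (Finset.univ.map x ∪ Finset.univ.map y)
    simp only [Finset.card_map, Finset.card_univ, Fintype.card_prod, Fintype.card_fin] at h1 h2
    have : n ^ 2 = n * n := sq n
    simp only [s]
    omega
  obtain ⟨e⟩ : Nonempty (Fin k ↪ s) := Function.Embedding.nonempty_of_card_le (by simpa using hs)
  let z : Fin k ↪ Pos n := e.trans (Function.Embedding.subtype _)
  have hz : ∀ b, z b ∉ Finset.univ.map x ∪ Finset.univ.map y := fun b =>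
    Finset.mem_compl.mp (e b).2
  have hzx : ∀ a b, x a ≠ z b := fun a b hab => hz b (by simp [← hab])
  have hzy : ∀ a b, z a ≠ y b := fun a b hab => hz a (by simp [hab])
  have := (h.within_of_disjoint hzx).trans (h.within_of_disjoint hzy)
  exact this.mono (by linarith)

/-! ### Decay of the distance over all pairs of tuples -/

/-- After `m` steps, the laws of the tuples from any two starting tuples are within `d`. -/
def Close (n k m : ℕ) (d : ℝ) : Prop := ∀ x y : Fin k ↪ Pos n, Within m x y d

theorem Close.mul {m l : ℕ} {d e : ℝ} (h : Close n k m d) (h' : Close n k l e) (hd : 0 ≤ d) :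
    Close n k (m + l) (d * e) := by
  intro x y f h0 h1
  rw [expect_add, expect_add]
  simp only [move_mul]
  set u : (Fin k ↪ Pos n) → ℝ := fun z => expect n m fun g => f (move g z) with hu
  have : Nonempty (Fin k ↪ Pos n) := ⟨x⟩
  obtain ⟨z₀, hz₀⟩ := Finite.exists_min u
  have hosc : ∀ z, u z - u z₀ ≤ d := fun z => h z z₀ f h0 h1
  have key := h' (x := x) (y := y) (fun z => (u z - u z₀) / d)
    (fun z => div_nonneg (by linarith [hz₀ z]) hd) (fun z => div_le_one_of_le₀ (hosc z) hd)
  have hsplit : ∀ z, u z = u z₀ + d * ((u z - u z₀) / d) := by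
    intro z
    rcases hd.eq_or_lt with rfl | hd'
    · have := hosc z
      have := hz₀ z
      simp only [zero_mul, add_zero]
      linarith
    · field_simp
      ring
  have hexp : ∀ w, (expect n l fun g => u (move g w)) =
      (expect n l fun _ => u z₀) + d * expect n l fun g => (u (move g w) - u z₀) / d := by
    intro w
    rw [← expect_const_mul, ← expect_add_fun]
    exact congrArg _ (funext fun g => hsplit _)
  change (expect n l fun g => u (move g x)) - (expect n l fun g => u (move g y)) ≤ _
  rw [hexp, hexp]
  nlinarith [mul_le_mul_of_nonneg_left key hd]

theorem close_zero (hn : 0 < n) : Close n k 0 1 := by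
  intro x y f h0 h1
  have h2 := expect_le_const hn 0 fun g => h1 (move g x)
  have h3 := const_le_expect hn 0 fun g => h0 (move g y)
  linarith

theorem Close.pow (hn : 0 < n) {m : ℕ} {d : ℝ} (h : Close n k m d) (hd : 0 ≤ d) (j : ℕ) :
    Close n k (j * m) (d ^ j) := by
  induction j with
  | zero => simpa using close_zero hn
  | succ j ih =>
    rw [add_mul, one_mul, pow_succ]
    exact ih.mul h (pow_nonneg hd j)

theorem Close.le (hn : 0 < n) {m m' : ℕ} {d d' : ℝ} (h : Close n k m d) (hm : m ≤ m')
    (hd : d ≤ d') : Close n k m' d' := fun x y => ((h x y).le hn hm).mono hd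

/-! ### The shuffle generates the symmetric group -/

/-- The permutations that are reached by sequences of rotations. -/
def reach (n : ℕ) : Submonoid (Equiv.Perm (Pos n)) :=
  Submonoid.closure (Set.range fun v : Fin n × Fin n => rotUL v.1 v.2)

theorem rotUL_mem_reach (i j : Fin n) : rotUL i j ∈ reach n :=
  Submonoid.subset_closure ⟨(i, j), rfl⟩

theorem rotUL_inv (i j : Fin n) : (rotUL i j)⁻¹ = rotUL i j := by
  ext1 p
  rw [Equiv.Perm.inv_eq_iff_eq]
  exact (upperLeftFun_involutive i j p).symm

/-- The transpositions that are reached are stable under conjugation by rotations. -/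
theorem swap_mem_reach {p q : Pos n} (h : Equiv.swap p q ∈ reach n) (i j : Fin n) :
    Equiv.swap (rotUL i j p) (rotUL i j q) ∈ reach n := by
  rw [Equiv.swap_apply_apply, rotUL_inv]
  exact mul_mem (mul_mem (rotUL_mem_reach i j) h) (rotUL_mem_reach i j)

/-- The rotation of the `1 × 2` rectangle is a transposition. -/
theorem rotUL_row (h : 1 < n) :
    rotUL (⟨0, by omega⟩ : Fin n) ⟨1, h⟩ =
      Equiv.swap ((⟨0, by omega⟩, ⟨0, by omega⟩) : Pos n) (⟨0, by omega⟩, ⟨1, h⟩) := by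
  ext1 ⟨⟨r, hr⟩, ⟨s, hs⟩⟩
  by_cases hp : r ≤ 0 ∧ s ≤ 1
  · obtain ⟨h1, h2⟩ := hp
    obtain rfl : r = 0 := by omega
    rw [rotUL_apply_of_le (by simp [Fin.le_def, h2])]
    interval_cases s
    · rw [Equiv.swap_apply_left]; simp [flipLow]
    · rw [Equiv.swap_apply_right]; simp [flipLow]
  · rw [rotUL_apply_of_not (by simpa [Fin.le_def] using hp), Equiv.swap_apply_of_ne_of_ne] <;>
    · simp only [ne_eq, Prod.mk.injEq, Fin.mk.injEq]
      omega

/-- The rotation of the `2 × 1` rectangle is a transposition. -/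
theorem rotUL_col (h : 1 < n) :
    rotUL (⟨1, h⟩ : Fin n) ⟨0, by omega⟩ =
      Equiv.swap ((⟨0, by omega⟩, ⟨0, by omega⟩) : Pos n) (⟨1, h⟩, ⟨0, by omega⟩) := by
  ext1 ⟨⟨r, hr⟩, ⟨s, hs⟩⟩
  by_cases hp : r ≤ 1 ∧ s ≤ 0
  · obtain ⟨h1, h2⟩ := hp
    obtain rfl : s = 0 := by omega
    rw [rotUL_apply_of_le (by simp [Fin.le_def, h1])]
    interval_cases r
    · rw [Equiv.swap_apply_left]; simp [flipLow]
    · rw [Equiv.swap_apply_right]; simp [flipLow]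
  · rw [rotUL_apply_of_not (by simpa [Fin.le_def] using hp), Equiv.swap_apply_of_ne_of_ne] <;>
    · simp only [ne_eq, Prod.mk.injEq, Fin.mk.injEq]
      omega

theorem swap_row_mem_reach {r s : ℕ} (hr : r < n) (hs : s + 1 < n) :
    Equiv.swap ((⟨r, hr⟩, ⟨s, by omega⟩) : Pos n) (⟨r, hr⟩, ⟨s + 1, hs⟩) ∈ reach n := by
  have h1 : 1 < n := by omega
  have h := swap_mem_reach (rotUL_row h1 ▸ rotUL_mem_reach _ _) ⟨r, hr⟩ ⟨s + 1, hs⟩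
  rw [rotUL_apply_of_le (by simp [Fin.le_def]), rotUL_apply_of_le (by simp [Fin.le_def]),
    Equiv.swap_comm] at h
  simpa [flipLow] using h

theorem swap_col_mem_reach {r s : ℕ} (hr : r + 1 < n) (hs : s < n) :
    Equiv.swap ((⟨r, by omega⟩, ⟨s, hs⟩) : Pos n) (⟨r + 1, hr⟩, ⟨s, hs⟩) ∈ reach n := by
  have h1 : 1 < n := by omega
  have h := swap_mem_reach (rotUL_col h1 ▸ rotUL_mem_reach _ _) ⟨r + 1, hr⟩ ⟨s, hs⟩
  rw [rotUL_apply_of_le (by simp [Fin.le_def]), rotUL_apply_of_le (by simp [Fin.le_def]),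
    Equiv.swap_comm] at h
  simpa [flipLow] using h

theorem swap_zero_mem_reach {r s : ℕ} (hr : r < n) (hs : s < n) :
    Equiv.swap ((⟨0, by omega⟩, ⟨0, by omega⟩) : Pos n) (⟨r, hr⟩, ⟨s, hs⟩) ∈ reach n := by
  induction r with
  | zero =>
    induction s with
    | zero => rw [Equiv.swap_self]; exact one_mem _
    | succ s ih => exact SubmonoidClass.swap_mem_trans _ (ih (by omega)) (swap_row_mem_reach hr hs)
  | succ r ih => exact SubmonoidClass.swap_mem_trans _ (ih (by omega)) (swap_col_mem_reach hr hs)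

theorem reach_eq_top : reach n = ⊤ := by
  rw [← top_le_iff, ← Equiv.Perm.mclosure_isSwap, Submonoid.closure_le]
  rintro _ ⟨⟨⟨r, hr⟩, ⟨s, hs⟩⟩, ⟨⟨r', hr'⟩, ⟨s', hs'⟩⟩, -, rfl⟩
  refine SubmonoidClass.swap_mem_trans _ ?_ (swap_zero_mem_reach hr' hs')
  rw [Equiv.swap_comm]
  exact swap_zero_mem_reach hr hs

theorem step_rotUL_pos (i j : Fin n) : 0 < step n (rotUL i j) := by
  have hn : (0 : ℝ) < n := by exact_mod_cast i.pos
  unfold step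
  refine Finset.sum_pos' (fun _ _ => Finset.sum_nonneg fun _ _ => by positivity)
    ⟨i, Finset.mem_univ _, Finset.sum_pos' (fun _ _ => by positivity) ⟨j, Finset.mem_univ _, ?_⟩⟩
  rw [if_pos rfl]
  positivity

theorem convPow_succ_pos {m : ℕ} {g : Equiv.Perm (Pos n)} (h : 0 < convPow (step n) m g)
    (i j : Fin n) : 0 < convPow (step n) (m + 1) (g * rotUL i j) := by
  refine Finset.sum_pos' (fun _ _ => mul_nonneg (convPow_nonneg _ _) (step_nonneg _))
    ⟨g, Finset.mem_univ _, mul_pos h ?_⟩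
  rw [inv_mul_cancel_left]
  exact step_rotUL_pos i j

/-- The rotation of the `1 × 1` rectangle is the identity, which makes the walk aperiodic. -/
theorem rotUL_zero (hn : 0 < n) : rotUL (⟨0, hn⟩ : Fin n) ⟨0, hn⟩ = 1 := by
  ext1 p
  by_cases hp : p.1 ≤ ⟨0, hn⟩ ∧ p.2 ≤ ⟨0, hn⟩
  · rw [rotUL_apply_of_le hp]
    have h1 := Fin.le_def.mp hp.1
    have h2 := Fin.le_def.mp hp.2
    refine Prod.ext (Fin.ext ?_) (Fin.ext ?_) <;> simp [flipLow] <;> simp at h1 h2 <;> omega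
  · rw [rotUL_apply_of_not hp]; rfl

theorem convPow_pos_of_le (hn : 0 < n) {m m' : ℕ} (hm : m ≤ m') {g : Equiv.Perm (Pos n)}
    (h : 0 < convPow (step n) m g) : 0 < convPow (step n) m' g := by
  induction m', hm using Nat.le_induction with
  | base => exact h
  | succ l _ ih => simpa [rotUL_zero hn] using convPow_succ_pos ih ⟨0, hn⟩ ⟨0, hn⟩

theorem exists_convPow_pos (hn : 0 < n) :
    ∃ m, ∀ g : Equiv.Perm (Pos n), 0 < convPow (step n) m g := by
  have h : ∀ g : Equiv.Perm (Pos n), ∃ m, 0 < convPow (step n) m g := by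
    intro g
    have hg : g ∈ reach n := by rw [reach_eq_top]; trivial
    refine Submonoid.closure_induction_right (motive := fun g _ => ∃ m, 0 < convPow (step n) m g)
      ⟨0, by simp [convPow]⟩ ?_ hg
    rintro x - _ ⟨v, rfl⟩ ⟨m, hm⟩
    exact ⟨m + 1, convPow_succ_pos hm _ _⟩
  choose m hm using h
  exact ⟨Finset.univ.sup m, fun g =>
    convPow_pos_of_le hn (Finset.le_sup (Finset.mem_univ g)) (hm g)⟩

theorem exists_move_eq (x y : Fin k ↪ Pos n) : ∃ h : Equiv.Perm (Pos n), move h x = y :=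
  have := Equiv.Perm.isMultiplyPretransitive (Pos n) k
  MulAction.exists_smul_eq (Equiv.Perm (Pos n)) x y

/-- For each single `n` some number of steps brings all tuples of cards close to each other. -/
theorem exists_close_half (hn : 0 < n) : ∃ M, ∀ k, Close n k M (1 / 2) := by
  obtain ⟨m, hm⟩ := exists_convPow_pos hn
  obtain ⟨g₀, hg₀⟩ := Finite.exists_min (convPow (step n) m)
  set p := convPow (step n) m g₀ with hp
  have hp0 : 0 < p := hm g₀
  have hsum : ∑ g, convPow (step n) m g = 1 := by
    simpa [expect] using expect_const hn m (1 : ℝ)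
  have hp1 : p ≤ 1 := by
    rw [← hsum]
    exact Finset.single_le_sum (fun g _ => convPow_nonneg m g) (Finset.mem_univ g₀)
  have hclose : ∀ k, Close n k m (1 - p) := by
    intro k x y f h0 h1
    obtain ⟨h, rfl⟩ := exists_move_eq x y
    simp only [← move_mul]
    have hshift : (expect n m fun g => f (move (g * h) x)) =
        ∑ g, convPow (step n) m (g * h⁻¹) * f (move g x) := by
      rw [← Equiv.sum_comp (Equiv.mulRight h)]
      simp [expect]
    rw [hshift, expect, ← Finset.sum_sub_distrib]
    have hle : ∀ g, convPow (step n) m g * f (move g x) -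
        convPow (step n) m (g * h⁻¹) * f (move g x) ≤ convPow (step n) m g - p := by
      intro g
      nlinarith [hg₀ g, hg₀ (g * h⁻¹), h0 (move g x), h1 (move g x)]
    refine (Finset.sum_le_sum fun g _ => hle g).trans ?_
    rw [Finset.sum_sub_distrib, hsum, Finset.sum_const, nsmul_eq_mul]
    have hcard : (1 : ℝ) ≤ (Finset.univ : Finset (Equiv.Perm (Pos n))).card := by
      exact_mod_cast Finset.card_pos.mpr ⟨1, Finset.mem_univ _⟩
    nlinarith
  obtain ⟨j, hj⟩ := exists_pow_lt_of_lt_one (show (0 : ℝ) < 1 / 2 by norm_num)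
    (show 1 - p < 1 by linarith)
  exact ⟨j * m, fun k => ((hclose k).pow hn (by linarith) j).le hn le_rfl hj.le⟩

end

section

/-! ### Rotations on the integer lattice -/

/-- The array as a subset of the lattice `ℤ × ℤ`. -/
def grid (n : ℕ) : Finset (ℤ × ℤ) := Finset.Ico 0 (n : ℤ) ×ˢ Finset.Ico 0 (n : ℤ)

/-- The upper-left rectangle with corner `v` covers `p`. -/
def CovUL (v p : ℤ × ℤ) : Prop := p.1 ≤ v.1 ∧ p.2 ≤ v.2

/-- The lower-right rectangle with corner `v` covers `p`. -/
def CovLR (v p : ℤ × ℤ) : Prop := v.1 ≤ p.1 ∧ v.2 ≤ p.2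

instance (v p : ℤ × ℤ) : Decidable (CovUL v p) := inferInstanceAs (Decidable (_ ∧ _))
instance (v p : ℤ × ℤ) : Decidable (CovLR v p) := inferInstanceAs (Decidable (_ ∧ _))

/-- The rotation of an upper-left rectangle, extended to the lattice. -/
def latUL (v p : ℤ × ℤ) : ℤ × ℤ := if CovUL v p then v - p else p

/-- The rotation of a lower-right rectangle, extended to the lattice. -/
def latLR (n : ℕ) (v p : ℤ × ℤ) : ℤ × ℤ :=
  if CovLR v p then v + ((n : ℤ) - 1, (n : ℤ) - 1) - p else p

/-- A position in the array, or one of the two points diagonally outside its upper-right and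
lower-left corners. No rotation covers these two points, and a position is moved exactly by the
rotations that separate it from them; they make it possible to treat the slow corners of the array
in the same way as pairs of cards that are close to each other. -/
def Valid (n : ℕ) (p : ℤ × ℤ) : Prop := p ∈ grid n ∨ p = (-1, (n : ℤ)) ∨ p = ((n : ℤ), -1)

/-- The rotations of upper-left rectangles that cover exactly one of the two points. -/
def sepUL (n : ℕ) (p q : ℤ × ℤ) : Finset (ℤ × ℤ) :=
  (grid n).filter fun v => ¬ (CovUL v p ↔ CovUL v q)

/-- The rotations of lower-right rectangles that cover exactly one of the two points. -/
def sepLR (n : ℕ) (p q : ℤ × ℤ) : Finset (ℤ × ℤ) :=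
  (grid n).filter fun v => ¬ (CovLR v p ↔ CovLR v q)

variable {n : ℕ}

theorem mem_sepUL {v p q : ℤ × ℤ} :
    v ∈ sepUL n p q ↔ v ∈ grid n ∧ ¬ (CovUL v p ↔ CovUL v q) := Finset.mem_filter

theorem mem_sepLR {v p q : ℤ × ℤ} :
    v ∈ sepLR n p q ↔ v ∈ grid n ∧ ¬ (CovLR v p ↔ CovLR v q) := Finset.mem_filter

theorem sepUL_comm (p q : ℤ × ℤ) : sepUL n p q = sepUL n q p := by
  simp only [sepUL, iff_comm]

theorem sepLR_comm (p q : ℤ × ℤ) : sepLR n p q = sepLR n q p := by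
  simp only [sepLR, iff_comm]

theorem card_sep_of_snd_le {p q : ℤ × ℤ} (hp : Valid n p) (hq : Valid n q) (hpq : p ≠ q)
    (h : p.2 ≤ q.2) :
    |p.2 - q.2| * (n + 1 - |p.1 - q.1|) ≤ ((sepUL n p q).card : ℤ) + (sepLR n p q).card := by
  obtain ⟨r, s⟩ := p
  obtain ⟨r', s'⟩ := q
  simp only [Valid, grid, Finset.mem_product, Finset.mem_Ico, Prod.mk.injEq, ne_eq] at hp hq hpq h ⊢
  have h1 : (Finset.Ico (max r r') (n : ℤ) ×ˢ Finset.Ico s s').card ≤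
      (sepUL n (r, s) (r', s')).card := by
    refine Finset.card_le_card fun v hv => ?_
    obtain ⟨i, j⟩ := v
    rw [mem_sepUL]
    simp only [CovUL, grid, Finset.mem_product, Finset.mem_Ico] at hv ⊢
    omega
  have h2 : (Finset.Ico 0 (min r r' + 1) ×ˢ Finset.Ico (s + 1) (s' + 1)).card ≤
      (sepLR n (r, s) (r', s')).card := by
    refine Finset.card_le_card fun v hv => ?_
    obtain ⟨i, j⟩ := v
    rw [mem_sepLR]
    simp only [CovLR, grid, Finset.mem_product, Finset.mem_Ico] at hv ⊢
    omega
  simp only [Finset.card_product, Int.card_Ico] at h1 h2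
  zify at h1 h2
  rw [Int.toNat_of_nonneg (by omega), Int.toNat_of_nonneg (by omega)] at h1 h2
  have e1 : |r - r'| = max r r' - min r r' := by rw [max_sub_min_eq_abs]; exact abs_sub_comm _ _
  have e2 : |s - s'| = s' - s := by rw [abs_sub_comm]; exact abs_of_nonneg (by omega)
  rw [e1, e2]
  linarith

theorem card_sep_of_fst_le {p q : ℤ × ℤ} (hp : Valid n p) (hq : Valid n q) (hpq : p ≠ q)
    (h : p.1 ≤ q.1) :
    |p.1 - q.1| * (n + 1 - |p.2 - q.2|) ≤ ((sepUL n p q).card : ℤ) + (sepLR n p q).card := by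
  obtain ⟨r, s⟩ := p
  obtain ⟨r', s'⟩ := q
  simp only [Valid, grid, Finset.mem_product, Finset.mem_Ico, Prod.mk.injEq, ne_eq] at hp hq hpq h ⊢
  have h1 : (Finset.Ico r r' ×ˢ Finset.Ico (max s s') (n : ℤ)).card ≤
      (sepUL n (r, s) (r', s')).card := by
    refine Finset.card_le_card fun v hv => ?_
    obtain ⟨i, j⟩ := v
    rw [mem_sepUL]
    simp only [CovUL, grid, Finset.mem_product, Finset.mem_Ico] at hv ⊢
    omega
  have h2 : (Finset.Ico (r + 1) (r' + 1) ×ˢ Finset.Ico 0 (min s s' + 1)).card ≤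
      (sepLR n (r, s) (r', s')).card := by
    refine Finset.card_le_card fun v hv => ?_
    obtain ⟨i, j⟩ := v
    rw [mem_sepLR]
    simp only [CovLR, grid, Finset.mem_product, Finset.mem_Ico] at hv ⊢
    omega
  simp only [Finset.card_product, Int.card_Ico] at h1 h2
  zify at h1 h2
  rw [Int.toNat_of_nonneg (by omega), Int.toNat_of_nonneg (by omega)] at h1 h2
  have e1 : |s - s'| = max s s' - min s s' := by rw [max_sub_min_eq_abs]; exact abs_sub_comm _ _
  have e2 : |r - r'| = r' - r := by rw [abs_sub_comm]; exact abs_of_nonneg (by omega)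
  rw [e1, e2]
  linarith

/-- The number of rotations that separate two points grows with their distance in the columns. -/
theorem le_card_sep_snd {p q : ℤ × ℤ} (hp : Valid n p) (hq : Valid n q) (hpq : p ≠ q) :
    |p.2 - q.2| * (n + 1 - |p.1 - q.1|) ≤ ((sepUL n p q).card : ℤ) + (sepLR n p q).card := by
  rcases le_total p.2 q.2 with h | h
  · exact card_sep_of_snd_le hp hq hpq h
  · rw [abs_sub_comm, abs_sub_comm p.1, sepUL_comm, sepLR_comm]
    exact card_sep_of_snd_le hq hp hpq.symm h

/-- The number of rotations that separate two points grows with their distance in the rows. -/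
theorem le_card_sep_fst {p q : ℤ × ℤ} (hp : Valid n p) (hq : Valid n q) (hpq : p ≠ q) :
    |p.1 - q.1| * (n + 1 - |p.2 - q.2|) ≤ ((sepUL n p q).card : ℤ) + (sepLR n p q).card := by
  rcases le_total p.1 q.1 with h | h
  · exact card_sep_of_fst_le hp hq hpq h
  · rw [abs_sub_comm, abs_sub_comm p.2, sepUL_comm, sepLR_comm]
    exact card_sep_of_fst_le hq hp hpq.symm h

/-- The sum over all rotations of a function of the displacement of two points. -/
def pairSum (n : ℕ) (f : ℤ × ℤ → ℝ) (p q : ℤ × ℤ) : ℝ :=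
  ∑ v ∈ grid n, (f (latUL v p - latUL v q) + f (latLR n v p - latLR n v q))

/-- A rotation that covers both points reverses their displacement; the rotations that cover
exactly one of them lead to distinct displacements, up to sign. -/
theorem pairSum_le {f : ℤ × ℤ → ℝ} (hf : ∀ v, 0 ≤ f v) (heven : ∀ v, f (-v) = f v) {S : ℝ}
    (hS : ∀ c : ℤ × ℤ, ∑ v ∈ grid n, f (v - c) ≤ S) (p q : ℤ × ℤ) :
    pairSum n f p q ≤ 2 * (n : ℝ) ^ 2 * f (p - q) + 2 * S -
      ((sepUL n p q).card + (sepLR n p q).card) * f (p - q) := by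
  have hcard : ((grid n).card : ℝ) = (n : ℝ) ^ 2 := by simp [grid, sq]
  have h1 : ∀ v, f (latUL v p - latUL v q) ≤
      f (p - q) + f (v - (p + q)) - if ¬ (CovUL v p ↔ CovUL v q) then f (p - q) else 0 := by
    intro v
    have h0 := hf (v - (p + q))
    by_cases hp : CovUL v p <;> by_cases hq : CovUL v q <;>
      simp only [latUL, hp, hq, if_true, if_false, iff_self, not_true, iff_true, iff_false,
        not_false_iff]
    · rw [show v - p - (v - q) = -(p - q) by ring, heven]; linarith
    · rw [show v - p - q = v - (p + q) by ring]; linarith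
    · rw [show p - (v - q) = -(v - (p + q)) by ring, heven]; linarith
    · linarith
  have h2 : ∀ v, f (latLR n v p - latLR n v q) ≤
      f (p - q) + f (v - (p + q - ((n : ℤ) - 1, (n : ℤ) - 1))) -
        if ¬ (CovLR v p ↔ CovLR v q) then f (p - q) else 0 := by
    intro v
    set w : ℤ × ℤ := ((n : ℤ) - 1, (n : ℤ) - 1)
    have h0 := hf (v - (p + q - w))
    by_cases hp : CovLR v p <;> by_cases hq : CovLR v q <;>
      simp only [latLR, hp, hq, if_true, if_false, iff_self, not_true, iff_true, iff_false,
        not_false_iff]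
    · rw [show v + w - p - (v + w - q) = -(p - q) by ring, heven]; linarith
    · rw [show v + w - p - q = v - (p + q - w) by ring]; linarith
    · rw [show p - (v + w - q) = -(v - (p + q - w)) by ring, heven]; linarith
    · linarith
  have h3 := Finset.sum_le_sum fun v (_ : v ∈ grid n) => h1 v
  have h4 := Finset.sum_le_sum fun v (_ : v ∈ grid n) => h2 v
  rw [Finset.sum_sub_distrib, Finset.sum_add_distrib, ← Finset.sum_filter, Finset.sum_const,
    Finset.sum_const, nsmul_eq_mul, nsmul_eq_mul, hcard] at h3 h4
  have h5 := hS (p + q)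
  have h6 := hS (p + q - ((n : ℤ) - 1, (n : ℤ) - 1))
  rw [pairSum, Finset.sum_add_distrib, sepUL, sepLR]
  linarith

end

section

variable {n : ℕ}

/-! ### The potential of a pair -/

/-- The supremum norm of a displacement. -/
def supNorm (v : ℤ × ℤ) : ℕ := max v.1.natAbs v.2.natAbs

/-- The potential of a displacement. The first term is, up to truncation at distance `n / K`, the
time needed to separate two cards at this distance; the other two count displacements with a row or
column coordinate below `g`. (At the displacement `0`, division by zero makes the first term
vanish.) -/
def pot (n K g : ℕ) (v : ℤ × ℤ) : ℝ :=
  max 0 ((n : ℝ) / supNorm v - K) + K * ((if v.1.natAbs < g then 1 else 0) +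
    if v.2.natAbs < g then 1 else 0)

theorem pot_nonneg (n K g : ℕ) (v : ℤ × ℤ) : 0 ≤ pot n K g v := by
  unfold pot; positivity

theorem pot_neg (n K g : ℕ) (v : ℤ × ℤ) : pot n K g (-v) = pot n K g v := by
  simp [pot, supNorm]

theorem pot_le (n K g : ℕ) (v : ℤ × ℤ) : pot n K g v ≤ n + 2 * K := by
  have h1 : (n : ℝ) / supNorm v ≤ n := by
    rcases Nat.eq_zero_or_pos (supNorm v) with h | h
    · simp [h]
    · exact div_le_self (Nat.cast_nonneg n) (by exact_mod_cast h)
  have h2 : max 0 ((n : ℝ) / supNorm v - K) ≤ n :=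
    max_le (Nat.cast_nonneg n) (by linarith [(Nat.cast_nonneg K : (0 : ℝ) ≤ K)])
  have h3 : ∀ P : Prop, ∀ _ : Decidable P, (if P then (1 : ℝ) else 0) ≤ 1 := by
    intro P _; split_ifs <;> norm_num
  have h4 := mul_le_mul_of_nonneg_left (add_le_add (h3 (v.1.natAbs < g) inferInstance)
    (h3 (v.2.natAbs < g) inferInstance)) (Nat.cast_nonneg K : (0 : ℝ) ≤ K)
  unfold pot
  linarith

/-- At distance `m` there are `8 m` displacements, each of which contributes at most `n / m`. -/
theorem sum_near_le {K : ℕ} (hK : 0 < K) (c : ℤ × ℤ) :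
    ∑ v ∈ grid n, max 0 ((n : ℝ) / supNorm (v - c) - K) ≤ 8 * (n : ℝ) ^ 2 / K := by
  have hK' : (0 : ℝ) < K := by exact_mod_cast hK
  have h1 : ∀ w : ℤ × ℤ, max 0 ((n : ℝ) / supNorm w - K) ≤
      ∑ m ∈ Finset.Icc 1 (n / K), if supNorm w = m then (n : ℝ) / m else 0 := by
    intro w
    refine max_le (Finset.sum_nonneg fun m _ => by positivity) ?_
    rw [Finset.sum_ite_eq]
    split_ifs with h
    · linarith
    · rw [Finset.mem_Icc, not_and_or] at h
      rcases h with h | h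
      · have : supNorm w = 0 := by omega
        simp [this]
      · have h2 : n < supNorm w * K := (Nat.div_lt_iff_lt_mul hK).mp (by omega)
        have h3 : (n : ℝ) < supNorm w * K := by exact_mod_cast h2
        rw [sub_nonpos, div_le_iff₀ (by
          by_contra h0
          have : (0 : ℝ) ≤ n := Nat.cast_nonneg n
          nlinarith)]
        linarith
  refine (Finset.sum_le_sum fun v _ => h1 (v - c)).trans ?_
  rw [Finset.sum_comm]
  have h4 : ∀ m ∈ Finset.Icc 1 (n / K),
      (∑ v ∈ grid n, if supNorm (v - c) = m then (n : ℝ) / m else 0) ≤ 8 * n := by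
    intro m hm
    have hm1 : 1 ≤ m := (Finset.mem_Icc.mp hm).1
    rw [← Finset.sum_filter, Finset.sum_const, nsmul_eq_mul]
    have hc : ((grid n).filter fun v => supNorm (v - c) = m).card ≤ 8 * m := by
      rw [← Int.card_box (by omega : m ≠ 0)]
      refine Finset.card_le_card_of_injOn (fun v => v - c) (fun v hv => ?_)
        (fun v _ w _ h => sub_left_injective h)
      have := (Finset.mem_filter.mp hv).2
      exact Int.mem_box.mpr this
    have hc' : ((((grid n).filter fun v => supNorm (v - c) = m).card : ℕ) : ℝ) ≤ 8 * m := by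
      exact_mod_cast hc
    have hm0 : (0 : ℝ) < m := by exact_mod_cast hm1
    calc _ ≤ 8 * (m : ℝ) * (n / m) := mul_le_mul_of_nonneg_right hc' (by positivity)
      _ = 8 * n := by field_simp
  refine (Finset.sum_le_card_nsmul _ _ _ h4).trans ?_
  rw [Nat.card_Icc, nsmul_eq_mul, Nat.add_sub_cancel, le_div_iff₀ hK']
  have h5 : ((n / K : ℕ) : ℝ) * K ≤ n := by exact_mod_cast Nat.div_mul_le_self n K
  nlinarith [(Nat.cast_nonneg n : (0 : ℝ) ≤ n)]

theorem card_Ico_near_le (n g : ℕ) (c : ℤ) :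
    ((Finset.Ico 0 (n : ℤ)).filter fun i => (i - c).natAbs < g).card ≤ 2 * g := by
  have : ((Finset.Ico 0 (n : ℤ)).filter fun i => (i - c).natAbs < g) ⊆
      Finset.Ico (c - g) (c + g) := by
    intro i hi
    have := (Finset.mem_filter.mp hi).2
    rw [Finset.mem_Ico]
    omega
  refine (Finset.card_le_card this).trans ?_
  rw [Int.card_Ico]
  omega

theorem sum_row_near_le (g : ℕ) (c : ℤ × ℤ) :
    ∑ v ∈ grid n, (if (v - c).1.natAbs < g then (1 : ℝ) else 0) ≤ 2 * g * n := by
  rw [grid, Finset.sum_product_right, Finset.sum_congr rfl fun j _ => Finset.sum_boole _ _]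
  have h := card_Ico_near_le n g c.1
  have h' : ((((Finset.Ico 0 (n : ℤ)).filter fun i => (i - c.1).natAbs < g).card : ℕ) : ℝ) ≤
      2 * g := by exact_mod_cast h
  simp only [Prod.fst_sub, Finset.sum_const, Int.card_Ico, nsmul_eq_mul]
  simp only [sub_zero, Int.toNat_natCast]
  nlinarith [(Nat.cast_nonneg n : (0 : ℝ) ≤ n)]

theorem sum_col_near_le (g : ℕ) (c : ℤ × ℤ) :
    ∑ v ∈ grid n, (if (v - c).2.natAbs < g then (1 : ℝ) else 0) ≤ 2 * g * n := by
  rw [grid, Finset.sum_product, Finset.sum_congr rfl fun j _ => Finset.sum_boole _ _]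
  have h := card_Ico_near_le n g c.2
  have h' : ((((Finset.Ico 0 (n : ℤ)).filter fun i => (i - c.2).natAbs < g).card : ℕ) : ℝ) ≤
      2 * g := by exact_mod_cast h
  simp only [Prod.snd_sub, Finset.sum_const, Int.card_Ico, nsmul_eq_mul]
  simp only [sub_zero, Int.toNat_natCast]
  nlinarith [(Nat.cast_nonneg n : (0 : ℝ) ≤ n)]

theorem sum_pot_le {K : ℕ} (hK : 0 < K) (g : ℕ) (c : ℤ × ℤ) :
    ∑ v ∈ grid n, pot n K g (v - c) ≤ 8 * (n : ℝ) ^ 2 / K + 4 * K * g * n := by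
  simp only [pot, Finset.sum_add_distrib, ← Finset.mul_sum]
  have h := mul_le_mul_of_nonneg_left
    (add_le_add (sum_row_near_le (n := n) g c) (sum_col_near_le (n := n) g c))
    (Nat.cast_nonneg K : (0 : ℝ) ≤ K)
  linarith [sum_near_le (n := n) hK c]

theorem supNorm_mul_le_card_sep {p q : ℤ × ℤ} (hp : Valid n p) (hq : Valid n q) (hpq : p ≠ q)
    (h : 2 * min (p - q).1.natAbs (p - q).2.natAbs ≤ n) :
    supNorm (p - q) * n ≤ 2 * ((sepUL n p q).card + (sepLR n p q).card) := by
  have h1 := le_card_sep_fst hp hq hpq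
  have h2 := le_card_sep_snd hp hq hpq
  simp only [Prod.fst_sub, Prod.snd_sub, supNorm] at h ⊢
  rw [Int.abs_eq_natAbs, Int.abs_eq_natAbs] at h1 h2
  zify
  zify at h
  set d : ℤ := |p.1 - q.1|
  set e : ℤ := |p.2 - q.2|
  have hd : 0 ≤ d := abs_nonneg _
  have he : 0 ≤ e := abs_nonneg _
  simp only [Int.natCast_natAbs] at h1 h2
  rcases le_total d e with hde | hde
  · rw [max_eq_right hde]; rw [min_eq_left hde] at h
    nlinarith
  · rw [max_eq_left hde]; rw [min_eq_right hde] at h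
    nlinarith

/-- A pair with a small row or column displacement loses potential at a rate bounded below: either
the two cards are close, and the rate of separation times the potential is bounded below, or they
are far apart and are separated at a rate bounded below. -/
theorem le_card_sep_mul_pot {K g : ℕ} (hK : 0 < K) (hg : 2 * K * g ≤ n) {p q : ℤ × ℤ}
    (hp : Valid n p) (hq : Valid n q) (hpq : p ≠ q)
    (h : (p - q).1.natAbs < g ∨ (p - q).2.natAbs < g) :
    (n : ℝ) ^ 2 / 4 ≤ ((sepUL n p q).card + (sepLR n p q).card) * pot n K g (p - q) := by
  have hg' : 2 * g ≤ n := by nlinarith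
  have hsep := supNorm_mul_le_card_sep hp hq hpq (by omega)
  have hm : 1 ≤ supNorm (p - q) := by
    rw [Nat.one_le_iff_ne_zero]
    intro h0
    refine hpq (sub_eq_zero.mp ?_)
    simp only [supNorm] at h0
    ext <;> simp only [Prod.fst_zero, Prod.snd_zero] <;> omega
  set m := supNorm (p - q)
  have hsep' : (m : ℝ) * n ≤ 2 * ((sepUL n p q).card + (sepLR n p q).card) := by
    exact_mod_cast hsep
  set N : ℝ := (sepUL n p q).card + (sepLR n p q).card with hN
  have hN0 : 0 ≤ N := by positivity
  have hK' : (0 : ℝ) < K := by exact_mod_cast hK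
  have hm' : (1 : ℝ) ≤ m := by exact_mod_cast hm
  have hind : (1 : ℝ) ≤ (if (p - q).1.natAbs < g then 1 else 0) +
      if (p - q).2.natAbs < g then 1 else 0 := by
    rcases h with h | h
    · rw [if_pos h]; split_ifs <;> norm_num
    · rw [if_pos h]; split_ifs <;> norm_num
  have hn0 : (0 : ℝ) ≤ n := Nat.cast_nonneg n
  by_cases hc : 2 * K * m ≤ n
  · have hc' : 2 * (K : ℝ) * m ≤ n := by exact_mod_cast hc
    have h1 : (n : ℝ) / (2 * m) ≤ pot n K g (p - q) := by
      have h2 : (n : ℝ) / (2 * m) ≤ (n : ℝ) / m - K := by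
        rw [le_sub_iff_add_le, div_add' _ _ _ (by positivity),
          div_le_div_iff₀ (by positivity) (by positivity)]
        nlinarith
      refine h2.trans ((le_max_right 0 _).trans ?_)
      exact le_add_of_nonneg_right (by positivity)
    calc (n : ℝ) ^ 2 / 4 = (m * n / 2) * (n / (2 * m)) := by field_simp; ring
      _ ≤ N * pot n K g (p - q) := mul_le_mul (by linarith) h1 (by positivity) hN0
  · have hc' : (n : ℝ) < 2 * (K : ℝ) * m := by exact_mod_cast not_le.mp hc
    have h1 : (K : ℝ) ≤ pot n K g (p - q) := by
      have := mul_le_mul_of_nonneg_left hind hK'.le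
      refine (by linarith : (K : ℝ) ≤ _).trans (le_add_of_nonneg_left (le_max_left 0 _))
    calc (n : ℝ) ^ 2 / 4 ≤ (m * n / 2) * K := by nlinarith
      _ ≤ N * pot n K g (p - q) := mul_le_mul (by linarith) h1 hK'.le hN0

/-- The drift of the pair potential. -/
theorem pairSum_pot_le {K g : ℕ} (hK : 0 < K) (hg : 2 * K * g ≤ n) {p q : ℤ × ℤ}
    (hp : Valid n p) (hq : Valid n q) (hpq : p ≠ q) :
    pairSum n (pot n K g) p q ≤ 2 * (n : ℝ) ^ 2 * pot n K g (p - q) +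
      2 * (8 * (n : ℝ) ^ 2 / K + 4 * K * g * n) -
      if (p - q).1.natAbs < g ∨ (p - q).2.natAbs < g then (n : ℝ) ^ 2 / 4 else 0 := by
  have h1 := pairSum_le (pot_nonneg n K g) (pot_neg n K g) (sum_pot_le (n := n) hK g) p q
  refine h1.trans (sub_le_sub_left ?_ _)
  split_ifs with h
  · exact le_card_sep_mul_pot hK hg hp hq hpq h
  · exact mul_nonneg (by positivity) (pot_nonneg _ _ _ _)

end

section

variable {n : ℕ}

/-! ### Cards become spread out in linear time -/

/-- The lattice point of a position. -/
def lat (p : Pos n) : ℤ × ℤ := ((p.1.val : ℤ), (p.2.val : ℤ))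

theorem lat_mem_grid (p : Pos n) : lat p ∈ grid n := by
  simp [lat, grid]

theorem covUL_lat {v p : Pos n} : CovUL (lat v) (lat p) ↔ p.1 ≤ v.1 ∧ p.2 ≤ v.2 :=
  and_congr Int.ofNat_le Int.ofNat_le

theorem covLR_lat {v p : Pos n} : CovLR (lat v) (lat p) ↔ v.1 ≤ p.1 ∧ v.2 ≤ p.2 :=
  and_congr Int.ofNat_le Int.ofNat_le

theorem lat_rotUL (i j : Fin n) (p : Pos n) : lat (rotUL i j p) = latUL (lat (i, j)) (lat p) := by
  by_cases h : p.1 ≤ i ∧ p.2 ≤ j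
  · have h1 := Fin.le_def.mp h.1
    have h2 := Fin.le_def.mp h.2
    rw [rotUL_apply_of_le (i := i) (j := j) (p := p) h, latUL, if_pos (covUL_lat.mpr h)]
    ext <;> simp [lat, flipLow] <;> omega
  · rw [rotUL_apply_of_not (i := i) (j := j) (p := p) h, latUL, if_neg (mt covUL_lat.mp h)]

theorem lat_rotLR (i j : Fin n) (p : Pos n) :
    lat (rotLR i j p) = latLR n (lat (i, j)) (lat p) := by
  by_cases h : i ≤ p.1 ∧ j ≤ p.2
  · have h1 := Fin.le_def.mp h.1
    have h2 := Fin.le_def.mp h.2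
    rw [rotLR_apply_of_le (i := i) (j := j) (p := p) h, latLR, if_pos (covLR_lat.mpr h)]
    ext <;> simp [lat, flipHigh] <;> omega
  · rw [rotLR_apply_of_not (i := i) (j := j) (p := p) h, latLR, if_neg (mt covLR_lat.mp h)]

theorem sum_fin_eq_sum_grid (F : ℤ × ℤ → ℝ) :
    ∑ i : Fin n, ∑ j : Fin n, F (lat (i, j)) = ∑ v ∈ grid n, F v := by
  have h : ∀ G : ℤ → ℝ, ∑ i : Fin n, G i.val = ∑ v ∈ Finset.Ico 0 (n : ℤ), G v := by
    intro G
    rw [Fin.sum_univ_eq_sum_range (fun i => G i) n]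
    refine Finset.sum_bij (fun i _ => (i : ℤ)) ?_ ?_ ?_ ?_
    · intro i hi
      simpa using hi
    · intro i _ j _ hij
      exact_mod_cast hij
    · intro v hv
      rw [Finset.mem_Ico] at hv
      exact ⟨v.toNat, by simp; omega, by simp; omega⟩
    · intro i _
      rfl
  rw [grid, Finset.sum_product]
  simp only [lat]
  rw [h fun v => ∑ j : Fin n, F (v, j.val)]
  exact Finset.sum_congr rfl fun v _ => h fun w => F (v, w)

variable {ι : Type*}

/-- The lattice points of a family of cards, together with the two points outside the corners. -/
def marked (c : ι → Pos n) : ι ⊕ Bool → ℤ × ℤ :=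
  Sum.elim (fun a => lat (c a)) fun b => if b then (-1, (n : ℤ)) else ((n : ℤ), -1)

theorem marked_valid (c : ι → Pos n) (a : ι ⊕ Bool) : Valid n (marked c a) := by
  rcases a with a | b
  · exact Or.inl (lat_mem_grid _)
  · cases b <;> simp [marked, Valid]

theorem lat_injective : Function.Injective (lat : Pos n → ℤ × ℤ) := by
  intro p q h
  simp only [lat, Prod.mk.injEq, Nat.cast_inj] at h
  exact Prod.ext (Fin.ext h.1) (Fin.ext h.2)

theorem marked_injective {c : ι → Pos n} (hc : Function.Injective c) :
    Function.Injective (marked c) := by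
  have hne : ∀ (p : Pos n) (b : Bool), lat p ≠ if b then (-1, (n : ℤ)) else ((n : ℤ), -1) := by
    intro p b h
    cases b <;> simp [lat] at h
  rintro (a | a) (b | b) h
  · exact congrArg _ (hc (lat_injective h))
  · exact absurd h (hne _ _)
  · exact absurd h.symm (hne _ _)
  · cases a <;> cases b <;> simp [marked] at h ⊢

theorem marked_rotUL (i j : Fin n) (c : ι → Pos n) (a : ι ⊕ Bool) :
    marked (fun a => rotUL i j (c a)) a = latUL (lat (i, j)) (marked c a) := by
  rcases a with a | b
  · exact lat_rotUL i j _
  · have h1 := i.isLt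
    have h2 := j.isLt
    cases b <;> simp [marked, latUL, CovUL, lat]

theorem marked_rotLR (i j : Fin n) (c : ι → Pos n) (a : ι ⊕ Bool) :
    marked (fun a => rotLR i j (c a)) a = latLR n (lat (i, j)) (marked c a) := by
  rcases a with a | b
  · exact lat_rotLR i j _
  · cases b <;> simp [marked, latLR, CovLR, lat] <;> intro h <;> omega

/-- All row and column displacements between cards, and all distances to the border of the array,
are at least `g`. -/
def Spread (g : ℕ) (c : ι → Pos n) : Prop :=
  ∀ a b, a ≠ b → g ≤ (marked c a - marked c b).1.natAbs ∧ g ≤ (marked c a - marked c b).2.natAbs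

theorem avg_pot_le {K g : ℕ} (hn : 0 < n) (hK : 0 < K) (hg : 2 * K * g ≤ n) {c : ι → Pos n}
    (hc : Function.Injective c) {a b : ι ⊕ Bool} (hab : a ≠ b) :
    (avg n fun s => pot n K g (marked (fun i => s (c i)) a - marked (fun i => s (c i)) b)) ≤
      pot n K g (marked c a - marked c b) + (8 / K + 4 * K * g / n) -
        if (marked c a - marked c b).1.natAbs < g ∨ (marked c a - marked c b).2.natAbs < g
          then (1 : ℝ) / 8 else 0 := by
  have hn' : (0 : ℝ) < n := by exact_mod_cast hn
  have hK' : (0 : ℝ) < K := by exact_mod_cast hK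
  have h := pairSum_pot_le hK hg (marked_valid c a) (marked_valid c b)
    ((marked_injective hc).ne hab)
  have hsum := sum_fin_eq_sum_grid (n := n) fun v =>
    pot n K g (latUL v (marked c a) - latUL v (marked c b)) +
      pot n K g (latLR n v (marked c a) - latLR n v (marked c b))
  rw [← pairSum] at hsum
  simp only [avg, marked_rotUL, marked_rotLR]
  rw [hsum, one_div, inv_mul_le_iff₀ (by positivity)]
  refine h.trans (le_of_eq ?_)
  split_ifs <;> field_simp <;> ring

open Classical in
/-- Four cards are spread out, with probability at least one half, at some time linear in `n`. -/
theorem exists_expect_spread [Fintype ι] (hι : Fintype.card ι = 4) {g : ℕ} (hg0 : 0 < g)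
    (hg : 134217728 * g ≤ n) {c : ι → Pos n} (hc : Function.Injective c) :
    ∃ l < 2000 * n, 1 / 2 ≤ expect n l fun h =>
      if h ∈ {h : Equiv.Perm (Pos n) | Spread g fun a => h (c a)} then 1 else 0 := by
  have hn0 : 0 < n := by omega
  have hn' : (0 : ℝ) < n := by exact_mod_cast hn0
  have hgn : (134217728 : ℝ) * g ≤ n := by exact_mod_cast hg
  -- The `30` ordered pairs of marked points contribute `30 * (8 / K + 4 * K * g / n)` to the drift;
  -- `K` and then `n / g` are chosen so large that this is below `1 / 32`.
  obtain ⟨K, hK⟩ : ∃ K : ℕ, K = 16384 := ⟨_, rfl⟩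
  have hKr : (K : ℝ) = 16384 := by rw [hK]; norm_num
  have hgK : 2 * K * g ≤ n := by rw [hK]; omega
  let V : Equiv.Perm (Pos n) → ℝ := fun h =>
    ∑ ab ∈ (Finset.univ : Finset (ι ⊕ Bool)).offDiag,
      pot n K g (marked (fun i => h (c i)) ab.1 - marked (fun i => h (c i)) ab.2)
  let bad : Equiv.Perm (Pos n) → ℝ := fun h => if Spread g fun a => h (c a) then 0 else 1 / 8
  have hcard : ((Finset.univ : Finset (ι ⊕ Bool)).offDiag).card = 30 := by
    rw [Finset.offDiag_card]
    simp [hι]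
  have hdrift : ∀ h, (avg n fun s => V (s * h)) ≤ V h + 1 / 32 - bad h := by
    intro h
    have hch : Function.Injective fun i => h (c i) := h.injective.comp hc
    have h1 : (avg n fun s => V (s * h)) = ∑ ab ∈ (Finset.univ : Finset (ι ⊕ Bool)).offDiag,
        avg n fun s => pot n K g
          (marked (fun i => s (h (c i))) ab.1 - marked (fun i => s (h (c i))) ab.2) := by
      simp only [← expect_one, V]
      rw [expect_sum]
      rfl
    rw [h1]
    refine (Finset.sum_le_sum fun ab hab => avg_pot_le hn0 (by omega) hgK hch
      (Finset.mem_offDiag.mp hab).2.2).trans ?_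
    rw [Finset.sum_sub_distrib, Finset.sum_add_distrib, Finset.sum_const, hcard, nsmul_eq_mul]
    have h2 : 4 * (K : ℝ) * g / n ≤ 1 / 2 ^ 11 := by
      rw [div_le_div_iff₀ hn' (by norm_num), hKr]
      linarith
    have h3 : bad h ≤ ∑ ab ∈ (Finset.univ : Finset (ι ⊕ Bool)).offDiag,
        if (marked (fun i => h (c i)) ab.1 - marked (fun i => h (c i)) ab.2).1.natAbs < g ∨
          (marked (fun i => h (c i)) ab.1 - marked (fun i => h (c i)) ab.2).2.natAbs < g
          then (1 : ℝ) / 8 else 0 := by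
      by_cases hs : Spread g fun a => h (c a)
      · simp only [bad, hs, if_true]
        exact Finset.sum_nonneg fun _ _ => by positivity
      · simp only [bad, hs, if_false]
        simp only [Spread, not_forall] at hs
        obtain ⟨a, b, hab, hs⟩ := hs
        have hmem : (a, b) ∈ (Finset.univ : Finset (ι ⊕ Bool)).offDiag := by simpa using hab
        refine le_trans ?_ (Finset.single_le_sum (fun _ _ => by positivity) hmem)
        rw [if_pos (by simpa only [not_and_or, not_le] using hs)]
    have h4 : 8 / (K : ℝ) = 1 / 2 ^ 11 := by rw [hKr]; norm_num
    simp only [V]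
    rw [h4]
    push_cast
    linarith
  have hV0 : V 1 ≤ 60 * n := by
    have h1 : V 1 ≤ _ := Finset.sum_le_card_nsmul _ _ _ fun ab _ => pot_le n K g _
    rw [hcard, nsmul_eq_mul] at h1
    have h2 : (1 : ℝ) ≤ g := by exact_mod_cast hg0
    rw [hKr] at h1
    push_cast at h1
    linarith
  have hVnn : ∀ h, 0 ≤ V h := fun h => Finset.sum_nonneg fun _ _ => pot_nonneg _ _ _ _
  clear_value V
  have hbad : ∀ l, expect n l bad = 1 / 8 - 1 / 8 * expect n l fun h =>
      if h ∈ {h : Equiv.Perm (Pos n) | Spread g fun a => h (c a)} then 1 else 0 := by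
    intro l
    rw [← expect_const_mul, ← expect_const hn0 l (1 / 8), ← expect_sub_fun]
    refine congrArg _ (funext fun h => ?_)
    simp only [bad, Set.mem_ofPred_eq]
    rw [expect_const hn0]
    split_ifs <;> norm_num
  clear_value bad
  obtain ⟨m, hm⟩ : ∃ m : ℕ, m = 2000 * n := ⟨_, rfl⟩
  have hmr : (m : ℝ) = 2000 * n := by rw [hm]; push_cast; rfl
  have hmain := sum_expect_le_of_drift hn0 hVnn hdrift m
  rw [← hm]
  by_contra! hcon
  have hge : ∀ l ∈ Finset.range m, (1 : ℝ) / 16 ≤ expect n l bad := by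
    intro l hl
    have h1 := hcon l (Finset.mem_range.mp hl)
    rw [hbad]
    linarith
  have h3 := Finset.card_nsmul_le_sum _ _ _ hge
  rw [Finset.card_range, nsmul_eq_mul] at h3
  linarith

end

section

variable {n : ℕ}

/-! ### Sorting spread-out cards by reversals of the top rows -/

/-- The rows of the cards differ by at least `g`, and no card is within `g` of the bottom, left or
right border of the array. -/
structure Room {ι : Type*} (g : ℕ) (c : ι → Pos n) : Prop where
  rows : ∀ a b, a ≠ b → (c a).1.val + g ≤ (c b).1.val ∨ (c b).1.val + g ≤ (c a).1.val
  bottom : ∀ a, (c a).1.val + g ≤ n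
  left : ∀ a, g ≤ (c a).2.val + 1
  right : ∀ a, (c a).2.val + g ≤ n

theorem Spread.room {ι : Type*} {g : ℕ} {c : ι → Pos n} (h : Spread g c) : Room g c where
  rows a b hab := by
    have := (h (Sum.inl a) (Sum.inl b) (by simpa using hab)).1
    simp only [marked, Sum.elim_inl, lat, Prod.fst_sub] at this
    omega
  bottom a := by
    have := (h (Sum.inl a) (Sum.inr false) (by simp)).1
    simp only [marked, Sum.elim_inl, Sum.elim_inr, lat, Prod.fst_sub, Bool.false_eq_true,
      if_false] at this
    omega
  left a := by
    have := (h (Sum.inl a) (Sum.inr false) (by simp)).2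
    simp only [marked, Sum.elim_inl, Sum.elim_inr, lat, Prod.snd_sub, Bool.false_eq_true,
      if_false] at this
    omega
  right a := by
    have := (h (Sum.inl a) (Sum.inr true) (by simp)).2
    simp only [marked, Sum.elim_inl, Sum.elim_inr, lat, Prod.snd_sub, if_true] at this
    omega

/-- `R'` arises from the rows `R` by reversing the order of the rows up to that of `p`, the new
rows staying above all the rows below that of `p`. -/
def Reversed {ι : Type*} (R R' : ι → ℕ) (p : ι) : Prop :=
  ∃ i, R p ≤ i ∧ (∀ a, R a ≤ R p → R' a + R a = i) ∧ ∀ a, R p < R a → R' a = R a ∧ i < R a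

/-- The rotation of a rectangle whose lower border lies in the gap below the card `p` and which
contains all columns with cards reverses the order of the rows and keeps a third of the room. -/
theorem Room.rotUL {ι : Type*} {g : ℕ} {c : ι → Pos n} (hc : Room (3 * g) c) (p : ι) {i j : Fin n}
    (hi1 : (c p).1.val + g ≤ i) (hi2 : i < (c p).1.val + 2 * g) (hj : n ≤ j.val + g) :
    Room g (fun a => rotUL i j (c a)) ∧
      Reversed (fun a => (c a).1.val) (fun a => (rotUL i j (c a)).1.val) p := by
  have hdich : ∀ a, (c a).1.val ≤ (c p).1.val ∨ (c p).1.val + 3 * g ≤ (c a).1.val := by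
    intro a
    by_cases h : a = p
    · left; rw [h]
    · rcases hc.rows a p h with h | h <;> omega
  have hlow : ∀ a, (c a).1.val ≤ (c p).1.val →
      (ArrayShuffle.rotUL i j (c a)).1.val = i - (c a).1.val ∧
      (ArrayShuffle.rotUL i j (c a)).2.val = j - (c a).2.val := by
    intro a ha
    have h2 := hc.right a
    rw [rotUL_apply_of_le (i := i) (j := j) (p := c a)
      ⟨Fin.le_def.mpr (by omega), Fin.le_def.mpr (by omega)⟩]
    exact ⟨rfl, rfl⟩
  have hhigh : ∀ a, (c p).1.val + 3 * g ≤ (c a).1.val → ArrayShuffle.rotUL i j (c a) = c a := by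
    intro a ha
    exact rotUL_apply_of_not fun h => by
      have := Fin.le_def.mp h.1
      omega
  have hp := hc.bottom p
  have hjn := j.isLt
  refine ⟨⟨?_, ?_, ?_, ?_⟩, i, by dsimp only; omega, ?_, ?_⟩
  · intro a b hab
    have := hc.rows a b hab
    rcases hdich a with ha | ha <;> rcases hdich b with hb | hb
    · rw [(hlow a ha).1, (hlow b hb).1]; omega
    · rw [(hlow a ha).1, hhigh b hb]; omega
    · rw [(hlow b hb).1, hhigh a ha]; omega
    · rw [hhigh a ha, hhigh b hb]; omega
  · intro a
    have := hc.bottom a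
    rcases hdich a with ha | ha
    · rw [(hlow a ha).1]; omega
    · rw [hhigh a ha]; omega
  · intro a
    have := hc.left a
    have := hc.right a
    rcases hdich a with ha | ha
    · rw [(hlow a ha).2]; omega
    · rw [hhigh a ha]; omega
  · intro a
    have := hc.left a
    have := hc.right a
    rcases hdich a with ha | ha
    · rw [(hlow a ha).2]; omega
    · rw [hhigh a ha]; omega
  · intro a ha
    dsimp only at ha ⊢
    rw [(hlow a ha).1]; omega
  · intro a ha
    dsimp only at ha ⊢
    rcases hdich a with ha' | ha'
    · omega
    · rw [hhigh a ha']; omega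

theorem le_expect_one_of_rotUL {S : Set (Equiv.Perm (Pos n))} [DecidablePred (· ∈ S)]
    {I J : Finset (Fin n)}
    (h : ∀ i ∈ I, ∀ j ∈ J, rotUL i j ∈ S) :
    (I.card * J.card : ℝ) / (2 * (n : ℝ) ^ 2) ≤ expect n 1 fun g => if g ∈ S then 1 else 0 := by
  rw [expect_one, avg, div_eq_inv_mul, one_div]
  refine mul_le_mul_of_nonneg_left ?_ (by positivity)
  have h1 : ∀ i j, (if i ∈ I then (1 : ℝ) else 0) * (if j ∈ J then 1 else 0) ≤
      (if rotUL i j ∈ S then 1 else 0) + if rotLR i j ∈ S then 1 else 0 := by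
    intro i j
    by_cases hi : i ∈ I
    · by_cases hj : j ∈ J
      · rw [if_pos hi, if_pos hj, if_pos (h i hi j hj)]
        split_ifs <;> norm_num
      · rw [if_neg hj, mul_zero]; positivity
    · rw [if_neg hi, zero_mul]; positivity
  refine le_trans (le_of_eq ?_) (Finset.sum_le_sum fun i _ => Finset.sum_le_sum fun j _ => h1 i j)
  rw [← Finset.sum_mul_sum]
  simp

/-- The cards of the tuple `x` together with an additional card `q`. -/
def cards {k : ℕ} (x : Fin k ↪ Pos n) (q : Pos n) : Option (Fin k) → Pos n := fun o => o.elim q x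

theorem cards_move {k : ℕ} (x : Fin k ↪ Pos n) (q : Pos n) (g : Equiv.Perm (Pos n)) :
    (fun o => g (cards x q o)) = cards (move g x) (g q) := by
  funext o
  cases o <;> rfl

theorem cards_injective {k : ℕ} {x y : Fin k ↪ Pos n} {a : Fin k} (hxy : ∀ b, b ≠ a → x b = y b)
    (ha : x a ≠ y a) : Function.Injective (cards x (y a)) := by
  have h : ∀ b, x b ≠ y a := by
    intro b hb
    by_cases hba : b = a
    · exact ha (hba ▸ hb)
    · rw [hxy b hba] at hb
      exact hba (y.injective hb)
  rintro (_ | b) (_ | b') hbb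
  · rfl
  · exact absurd hbb.symm (h b')
  · exact absurd hbb (h b)
  · exact congrArg some (x.injective hbb)

theorem card_filter_Ico_fin {l u : ℕ} (hu : u ≤ n) :
    ((Finset.univ : Finset (Fin n)).filter fun i => l ≤ i.val ∧ i.val < u).card = u - l := by
  rw [← Nat.card_Ico, ← Finset.card_map Fin.valEmbedding]
  congr 1
  ext m
  simp only [Finset.mem_map, Finset.mem_filter, Finset.mem_univ, true_and, Fin.valEmbedding_apply,
    Finset.mem_Ico]
  constructor
  · rintro ⟨i, hi, rfl⟩; exact hi
  · intro hm; exact ⟨⟨m, by omega⟩, hm, rfl⟩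

/-- Two tuples that differ in the card `a`, in a configuration with gaps `g` whose rows satisfy
`Q`, can be made to agree. -/
def ContractsFrom (n r : ℕ) (p : ℝ) {k : ℕ} (a : Fin k) (g : ℕ) (Q : (Option (Fin k) → ℕ) → Prop) :
    Prop :=
  ∀ x y : Fin k ↪ Pos n, (∀ b, b ≠ a → x b = y b) → Room g (cards x (y a)) →
    Q (fun o => (cards x (y a) o).1.val) → Contracts r p x y

/-- A reversal that leads from rows with `Q` to rows with `Q'` is achieved by one step with
probability of order `(h / n) ^ 2`. -/
theorem ContractsFrom.reverse {r : ℕ} {p : ℝ} {k : ℕ} {a : Fin k} {g h : ℕ}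
    {Q Q' : (Option (Fin k) → ℕ) → Prop} (hp : 0 ≤ p) (hhg : h ≤ g)
    (hC : ContractsFrom n r p a g Q')
    (hQ : ∀ R, Function.Injective R → Q R → ∃ o, ∀ R', Reversed R R' o → Q' R') :
    ContractsFrom n (r + 1) (h * h / (2 * (n : ℝ) ^ 2) * p) a (3 * g) Q := by
  classical
  intro x y hxy hroom hQx
  -- For `h = 0` the claimed probability is zero; otherwise `g > 0` and the rows are distinct.
  rcases Nat.eq_zero_or_pos h with rfl | hh
  · simp only [Nat.cast_zero, zero_mul, zero_div]
    intro m d h0 hd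
    simpa using (hd x y ⟨a, hxy⟩).add (x a).1.pos (r + 1)
  have hinj : Function.Injective fun o => (cards x (y a) o).1.val := by
    intro o o' hoo
    by_contra hne
    have := hroom.rows o o' hne
    dsimp only at hoo
    omega
  obtain ⟨o, ho⟩ := hQ _ hinj hQx
  have hbot := hroom.bottom o
  set ρ := (cards x (y a) o).1.val
  let I : Finset (Fin n) := Finset.univ.filter fun i => ρ + g ≤ i.val ∧ i.val < ρ + g + h
  let J : Finset (Fin n) := Finset.univ.filter fun i => n - h ≤ i.val ∧ i.val < n
  have hI : I.card = h := by
    rw [card_filter_Ico_fin (by omega)]; omega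
  have hJ : J.card = h := by
    rw [card_filter_Ico_fin le_rfl]; omega
  let S : Set (Equiv.Perm (Pos n)) := {σ | ∃ i ∈ I, ∃ j ∈ J, rotUL i j = σ}
  refine Contracts.of_expect (x a).1.pos ⟨a, hxy⟩ (l := 1) (S := S) hp ?_ ?_
  · rintro _ ⟨i, hi, j, hj, rfl⟩
    have hi' := (Finset.mem_filter.mp hi).2
    have hj' := (Finset.mem_filter.mp hj).2
    obtain ⟨h1, h2⟩ := hroom.rotUL o (i := i) (j := j) (by omega) (by omega) (by omega)
    rw [cards_move] at h1
    refine hC _ _ (fun b hb => by simp [hxy b hb]) h1 ?_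
    have h3 := ho _ h2
    rw [show (fun o => (cards (move (rotUL i j) x) (move (rotUL i j) y a) o).1.val) =
      fun o => ((fun o => rotUL i j (cards x (y a) o)) o).1.val by rw [cards_move]; rfl]
    exact h3
  · have := le_expect_one_of_rotUL (S := S) (I := I) (J := J) fun i hi j hj => ⟨i, hi, j, hj, rfl⟩
    rwa [hI, hJ] at this

/-- When both versions of the differing card are above all other cards, they can be made to agree
in one step. -/
theorem contractsFrom_top {k : ℕ} (a : Fin k) (h : ℕ) :
    ContractsFrom n 1 (h * h / (2 * (n : ℝ) ^ 2)) a h fun R =>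
      ∀ b, b ≠ a → R (some a) < R (some b) ∧ R none < R (some b) := by
  intro x y hxy hroom hQ
  have h1 := hroom.bottom none
  have h2 := hroom.bottom (some a)
  have h3 := hroom.right none
  have h4 := hroom.right (some a)
  simp only [cards, Option.elim_none, Option.elim_some] at h1 h2 h3 h4
  refine contracts_one hxy (A := max (x a).1.val (y a).1.val + h) (B := n) (by omega) le_rfl
    (by omega) (by omega) fun b hb => ?_
  have h5 := hroom.rows (some a) (some b) (by simpa using hb.symm)
  have h6 := hroom.rows none (some b) (by simp)
  have h7 := hQ b hb
  simp only [cards, Option.elim_none, Option.elim_some] at h5 h6 h7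
  omega

/-- Four cards in general position: with two of them being versions of the same card, the other
two are brought to the bottom by four reversals. -/
theorem contractsFrom_room (a : Fin 3) (h : ℕ) :
    ContractsFrom n 5 ((h * h / (2 * (n : ℝ) ^ 2)) ^ 5) a (3 * (3 * (3 * (3 * h))))
      fun _ => True := by
  obtain ⟨b, c, hab, hac, hbc, hall⟩ :
      ∃ b c : Fin 3, a ≠ b ∧ a ≠ c ∧ b ≠ c ∧ ∀ d, d = a ∨ d = b ∨ d = c := by
    revert a; decide
  have hall' : ∀ P : Option (Fin 3) → Prop, P none → P (some a) → P (some b) → P (some c) →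
      ∀ o, P o := by
    rintro P h0 h1 h2 h3 (_ | d)
    · exact h0
    · rcases hall d with rfl | rfl | rfl <;> assumption
  set β : ℝ := h * h / (2 * (n : ℝ) ^ 2)
  have hβ : 0 ≤ β := by positivity
  have hne : ∀ R : Option (Fin 3) → ℕ, Function.Injective R → R none ≠ R (some a) ∧
      R none ≠ R (some b) ∧ R none ≠ R (some c) ∧ R (some a) ≠ R (some b) ∧
      R (some a) ≠ R (some c) ∧ R (some b) ≠ R (some c) := fun R hR =>
    ⟨hR.ne (by simp), hR.ne (by simp), hR.ne (by simp), hR.ne (by simpa using hab),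
      hR.ne (by simpa using hac), hR.ne (by simpa using hbc)⟩
  have s0 := contractsFrom_top (n := n) a h
  -- `c` is the topmost card and `b` the lowest; reverse everything above `b`.
  have s1 := s0.reverse hβ le_rfl (Q := fun R => R none < R (some b) ∧ R (some a) < R (some b) ∧
    R (some c) < R none ∧ R (some c) < R (some a)) (by
      intro R hR hQ
      have hn := hne R hR
      refine ⟨if R none < R (some a) then some a else none, ?_⟩
      rintro R' ⟨i, hi, hlow, hhigh⟩ d hd
      have hb := hhigh (some b)
      have hn0 := hlow none
      have ha := hlow (some a)
      have hc := hlow (some c)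
      rcases hall d with rfl | rfl | rfl
      · exact absurd rfl hd
      · split_ifs at * <;> omega
      · split_ifs at * <;> omega)
  -- `b` is the lowest card; reverse the cards from `c` upwards.
  have s2 := s1.reverse (mul_nonneg hβ hβ) (h := h) (by omega) (Q := fun R =>
    R none < R (some b) ∧ R (some a) < R (some b) ∧ R (some c) < R (some b)) (by
      intro R hR hQ
      have hn := hne R hR
      refine ⟨some c, ?_⟩
      rintro R' ⟨i, hi, hlow, hhigh⟩
      have hb := hhigh (some b)
      have hn0 := hlow none
      have hn1 := hhigh none
      have ha := hlow (some a)
      have ha1 := hhigh (some a)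
      have hc := hlow (some c)
      omega)
  -- `b` is the topmost card; reverse all cards.
  have s3 := s2.reverse (by positivity) (h := h) (by omega) (Q := fun R =>
    R (some b) < R none ∧ R (some b) < R (some a) ∧ R (some b) < R (some c)) (by
      intro R hR hQ
      obtain ⟨o, ho⟩ := Finite.exists_max R
      refine ⟨o, ?_⟩
      rintro R' ⟨i, hi, hlow, hhigh⟩
      have hb := hlow (some b) (ho _)
      have hn0 := hlow none (ho _)
      have ha := hlow (some a) (ho _)
      have hc := hlow (some c) (ho _)
      omega)
  -- Reverse the cards from `b` upwards.
  have s4 := s3.reverse (by positivity) (h := h) (by omega) (Q := fun _ => True) (by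
      intro R hR _
      have hn := hne R hR
      refine ⟨some b, ?_⟩
      rintro R' ⟨i, hi, hlow, hhigh⟩
      have hb := hlow (some b)
      have hn0 := hlow none
      have hn1 := hhigh none
      have ha := hlow (some a)
      have ha1 := hhigh (some a)
      have hc := hlow (some c)
      have hc1 := hhigh (some c)
      omega)
  have : β ^ 5 = β * (β * (β * (β * β))) := by ring
  rw [this]
  exact s4

/-- For large `n`, two triples that differ in one card can be made to agree in linear time, with
probability bounded below. -/
theorem exists_contracts_three :
    ∃ (p : ℝ) (N : ℕ), 0 < p ∧ p ≤ 1 ∧ 3 ≤ N ∧ ∀ n, N ≤ n → ∀ x y : Fin 3 ↪ Pos n, Adj x y →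
      Contracts (2005 * n) p x y := by
  obtain ⟨D, hD⟩ : ∃ D : ℕ, D = 81 * 134217728 := ⟨_, rfl⟩
  have hDr : (1 : ℝ) ≤ D := by rw [hD]; norm_num
  have hβ0 : (0 : ℝ) < 1 / (8 * (D : ℝ) ^ 2) := by positivity
  have hβ1 : 1 / (8 * (D : ℝ) ^ 2) ≤ 1 := by
    rw [div_le_one (by positivity)]
    nlinarith
  refine ⟨1 / 2 * (1 / (8 * (D : ℝ) ^ 2)) ^ 5, D, by positivity, ?_, by omega, ?_⟩
  · have := pow_le_one₀ hβ0.le hβ1 (n := 5)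
    linarith
  classical
  intro n hn x y hxy
  have hn0 : 0 < n := by omega
  have hn' : (0 : ℝ) < n := by exact_mod_cast hn0
  obtain ⟨a, hxy⟩ := hxy
  by_cases ha : x a = y a
  · have : x = y := by
      ext1 b
      by_cases hb : b = a
      · rw [hb, ha]
      · exact hxy b hb
    rw [this]
    refine contracts_self _ ?_ _
    have := pow_le_one₀ hβ0.le hβ1 (n := 5)
    linarith
  obtain ⟨h, hh⟩ : ∃ h, h = n / D := ⟨_, rfl⟩
  have hh1 : D * h ≤ n := by rw [hh]; exact Nat.mul_div_le n D
  have hh0 : 0 < h := by rw [hh]; exact Nat.div_pos hn (by omega)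
  have hh2 : n ≤ 2 * D * h := by
    have := Nat.lt_mul_div_succ n (show 0 < D by omega)
    rw [← hh] at this
    nlinarith
  have hβ : 1 / (8 * (D : ℝ) ^ 2) ≤ h * h / (2 * (n : ℝ) ^ 2) := by
    have h2 : (n : ℝ) ≤ 2 * D * h := by exact_mod_cast hh2
    rw [div_le_div_iff₀ (by positivity) (by positivity)]
    nlinarith
  obtain ⟨l, hl, hexp⟩ := exists_expect_spread (ι := Option (Fin 3)) (by simp)
    (g := 3 * (3 * (3 * (3 * h)))) (by omega) (by rw [hD] at hh1; omega) (cards_injective hxy ha)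
  have key := Contracts.of_expect hn0 ⟨a, hxy⟩ (r := 5) (p := (h * h / (2 * (n : ℝ) ^ 2)) ^ 5)
    (by positivity) (fun g hg => by
      have hs : Spread _ fun o => g (cards x (y a) o) := hg
      rw [cards_move] at hs
      exact contractsFrom_room a h _ _ (fun b hb => by simp [hxy b hb]) hs.room trivial) hexp
  refine (key.le hn0 (by omega)).mono ?_
  exact mul_le_mul_of_nonneg_left (pow_le_pow_left₀ hβ0.le hβ 5) (by norm_num)

/-- Three cards are brought close to equilibrium in linear time. -/
theorem exists_close_three : ∃ C N : ℕ, ∀ n, N ≤ n → Close n 3 (C * n) (1 / 2) := by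
  obtain ⟨p, N, hp0, hp1, hN, hC⟩ := exists_contracts_three
  obtain ⟨j, hj⟩ := exists_pow_lt_of_lt_one (show (0 : ℝ) < 1 / 12 by norm_num)
    (show 1 - p < 1 by linarith)
  refine ⟨j * 2005, N, fun n hn x y => ?_⟩
  have h1 := (AdjBound.pow (by omega) hp1 (hC n hn) j).within (by nlinarith) x y
  rw [mul_assoc]
  refine h1.mono ?_
  push_cast
  linarith

end

section

variable {n k : ℕ}

/-! ### From three cards to `k` cards -/

/-- Three distinct positions as a tuple. -/
def triple {p q r : Pos n} (hpq : p ≠ q) (hpr : p ≠ r) (hqr : q ≠ r) : Fin 3 ↪ Pos n where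
  toFun := ![p, q, r]
  inj' := by
    intro i j h
    fin_cases i <;> fin_cases j <;> simp_all [eq_comm]

theorem Close.triple_le {m : ℕ} {ε : ℝ} (h : Close n 3 m ε) (P : Pos n → Pos n → Pos n → Prop)
    [∀ p q r, Decidable (P p q r)] {p q r p' q' r' : Pos n} (hpq : p ≠ q) (hpr : p ≠ r)
    (hqr : q ≠ r) (hpq' : p' ≠ q') (hpr' : p' ≠ r') (hqr' : q' ≠ r') :
    (expect n m fun g => if P (g p) (g q) (g r) then 1 else 0) ≤
      (expect n m fun g => if P (g p') (g q') (g r') then 1 else 0) + ε := by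
  have := h (triple hpq hpr hqr) (triple hpq' hpr' hqr')
    (fun z => if P (z 0) (z 1) (z 2) then 1 else 0) (fun z => by positivity)
    (fun z => by split_ifs <;> norm_num)
  exact sub_le_iff_le_add'.mp this

/-- The probability that two given cards are both in `B` is nearly what it is for a random pair. -/
theorem Close.le_expect_pair {m : ℕ} {ε : ℝ} (h : Close n 3 m ε) (hn : 1 < n) (B : Finset (Pos n))
    {p q : Pos n} (hpq : p ≠ q) :
    (B.card : ℝ) * (B.card - 1) ≤
      (n : ℝ) ^ 2 * ((n : ℝ) ^ 2 - 1) *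
        ((expect n m fun g => if g p ∈ B ∧ g q ∈ B then 1 else 0) + ε) := by
  have hex : ∀ p q : Pos n, ∃ r, p ≠ r ∧ q ≠ r := by
    intro p q
    have hc : ({p, q} : Finset (Pos n)).card < (Finset.univ : Finset (Pos n)).card := by
      refine (Finset.card_le_two).trans_lt ?_
      simp only [Finset.card_univ, Fintype.card_prod, Fintype.card_fin]
      nlinarith
    obtain ⟨r, -, hr⟩ := Finset.exists_mem_notMem_of_card_lt_card hc
    simp only [Finset.mem_insert, Finset.mem_singleton, not_or] at hr
    exact ⟨r, Ne.symm hr.1, Ne.symm hr.2⟩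
  have hle : ∀ ab ∈ (Finset.univ : Finset (Pos n)).offDiag,
      (expect n m fun g => if g ab.1 ∈ B ∧ g ab.2 ∈ B then 1 else 0) ≤
        (expect n m fun g => if g p ∈ B ∧ g q ∈ B then (1 : ℝ) else 0) + ε := by
    intro ab hab
    obtain ⟨r, h1, h2⟩ := hex ab.1 ab.2
    obtain ⟨r', h1', h2'⟩ := hex p q
    exact h.triple_le (fun p q _ => p ∈ B ∧ q ∈ B) (Finset.mem_offDiag.mp hab).2.2 h1 h2 hpq h1' h2'
  have hsum := Finset.sum_le_card_nsmul _ _ _ hle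
  rw [← expect_sum] at hsum
  have hcount : ∀ g : Equiv.Perm (Pos n), (∑ ab ∈ (Finset.univ : Finset (Pos n)).offDiag,
      if g ab.1 ∈ B ∧ g ab.2 ∈ B then (1 : ℝ) else 0) = (B.card : ℝ) * (B.card - 1) := by
    intro g
    refine (Finset.sum_equiv (Equiv.prodCongr g g) (t := (Finset.univ : Finset (Pos n)).offDiag)
      (g := fun ab => if ab.1 ∈ B ∧ ab.2 ∈ B then (1 : ℝ) else 0)
      (fun ab => by simp [Finset.mem_offDiag, -Prod.forall]) (fun _ _ => rfl)).trans ?_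
    rw [Finset.sum_boole]
    have : ((Finset.univ : Finset (Pos n)).offDiag.filter fun ab => ab.1 ∈ B ∧ ab.2 ∈ B) =
        B.offDiag := by
      ext ab
      simp only [Finset.mem_filter, Finset.mem_offDiag, Finset.mem_univ, true_and]
      tauto
    rw [this, Finset.offDiag_card, Nat.cast_sub (Nat.le_mul_self _)]
    push_cast
    ring
  simp only [hcount] at hsum
  rw [expect_const (by omega), nsmul_eq_mul, Finset.offDiag_card,
    Nat.cast_sub (Nat.le_mul_self _)] at hsum
  simp only [Finset.card_univ, Fintype.card_prod, Fintype.card_fin] at hsum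
  push_cast at hsum
  refine hsum.trans (le_of_eq ?_)
  ring

/-- The probability that a third card is in `W` while two given cards are in `B` is nearly what it
is for a random third card. -/
theorem Close.expect_triple_le {m : ℕ} {ε : ℝ} (h : Close n 3 m ε) (hn : 1 < n)
    (B W : Finset (Pos n)) {p q r : Pos n} (hpq : p ≠ q) (hpr : p ≠ r) (hqr : q ≠ r) :
    ((n : ℝ) ^ 2 - 2) * ((expect n m fun g => if g p ∈ B ∧ g q ∈ B ∧ g r ∈ W then 1 else 0) - ε) ≤
      W.card * expect n m fun g => if g p ∈ B ∧ g q ∈ B then 1 else 0 := by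
  have hle : ∀ r' ∈ ({p, q} : Finset (Pos n))ᶜ,
      (expect n m fun g => if g p ∈ B ∧ g q ∈ B ∧ g r ∈ W then (1 : ℝ) else 0) - ε ≤
        expect n m fun g => if g p ∈ B ∧ g q ∈ B ∧ g r' ∈ W then 1 else 0 := by
    intro r' hr'
    simp only [Finset.mem_compl, Finset.mem_insert, Finset.mem_singleton, not_or] at hr'
    rw [sub_le_iff_le_add]
    exact h.triple_le (fun p q r => p ∈ B ∧ q ∈ B ∧ r ∈ W) hpq hpr hqr hpq (Ne.symm hr'.1)
      (Ne.symm hr'.2)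
  have hsum := Finset.card_nsmul_le_sum _ _ _ hle
  rw [← expect_sum, nsmul_eq_mul, Finset.card_compl, Finset.card_pair hpq,
    Nat.cast_sub (by simp only [Fintype.card_prod, Fintype.card_fin]; nlinarith)] at hsum
  simp only [Fintype.card_prod, Fintype.card_fin] at hsum
  push_cast at hsum
  rw [sq]
  refine hsum.trans ?_
  rw [← expect_const_mul]
  refine expect_mono m fun g => ?_
  by_cases hg : g p ∈ B ∧ g q ∈ B
  · simp only [hg.1, hg.2, true_and, if_true, and_self, mul_one]
    refine (Finset.sum_le_univ_sum_of_nonneg fun _ => by positivity).trans (le_of_eq ?_)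
    rw [Equiv.sum_comp g fun r => if r ∈ W then (1 : ℝ) else 0]
    simp
  · simp only [hg, ← and_assoc, false_and, if_false, Finset.sum_const_zero, mul_zero, le_refl]

open Classical in
/-- If three cards are nearly in equilibrium, then with probability of the order of that in
equilibrium both versions of the differing card are in `B` while no other card is in `W`. -/
theorem Close.le_expect_good {m : ℕ} {ε : ℝ} (h : Close n 3 m ε) (hε : 0 ≤ ε) (hn : 1 < n)
    (B W : Finset (Pos n)) (hB : 2 ≤ B.card) (hW : 2 * k * W.card + 2 ≤ n ^ 2)
    {x y : Fin k ↪ Pos n} {a : Fin k} (hxy : ∀ b, b ≠ a → x b = y b) (ha : x a ≠ y a) :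
    (B.card : ℝ) ^ 2 / (4 * (n : ℝ) ^ 4) - (k + 1) * ε ≤ expect n m fun g =>
      if g ∈ {g : Equiv.Perm (Pos n) | g (x a) ∈ B ∧ g (y a) ∈ B ∧ ∀ b, b ≠ a → g (x b) ∉ W}
        then 1 else 0 := by
  set J := expect n m fun g => if g (x a) ∈ B ∧ g (y a) ∈ B then (1 : ℝ) else 0 with hJ
  have hn' : (1 : ℝ) < n := by exact_mod_cast hn
  have hn2 : (4 : ℝ) ≤ (n : ℝ) ^ 2 := by
    have : (2 : ℝ) ≤ n := by exact_mod_cast hn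
    nlinarith
  have hJ0 : 0 ≤ J := const_le_expect (by omega) m fun g => by positivity
  have hW' : 2 * (k : ℝ) * W.card ≤ (n : ℝ) ^ 2 - 2 := by
    have : (2 * k * W.card + 2 : ℝ) ≤ (n : ℝ) ^ 2 := by exact_mod_cast hW
    linarith
  have hthird : ∀ b ∈ (Finset.univ : Finset (Fin k)).erase a,
      (expect n m fun g => if g (x a) ∈ B ∧ g (y a) ∈ B ∧ g (x b) ∈ W then (1 : ℝ) else 0) ≤
        W.card * J / ((n : ℝ) ^ 2 - 2) + ε := by
    intro b hb
    have hba := (Finset.mem_erase.mp hb).1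
    have hinj := cards_injective hxy ha
    have h1 := h.expect_triple_le hn B W ha (x.injective.ne hba.symm)
      (fun e => by simpa using hinj (a₁ := none) (a₂ := some b) e)
    rw [← sub_le_iff_le_add, le_div_iff₀ (by linarith)]
    linarith
  have hsum := Finset.sum_le_card_nsmul _ _ _ hthird
  rw [← expect_sum, nsmul_eq_mul, Finset.card_erase_of_mem (Finset.mem_univ _), Finset.card_univ,
    Fintype.card_fin] at hsum
  have hk : ((k - 1 : ℕ) : ℝ) ≤ k := by exact_mod_cast Nat.sub_le k 1
  have hhalf : (k : ℝ) * (W.card * J / ((n : ℝ) ^ 2 - 2) + ε) ≤ J / 2 + k * ε := by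
    rw [mul_add]
    refine add_le_add_left ?_ _
    rw [← mul_div_assoc, div_le_div_iff₀ (by linarith) (by norm_num)]
    nlinarith [mul_le_mul_of_nonneg_left hW' hJ0]
  have hpos : 0 ≤ W.card * J / ((n : ℝ) ^ 2 - 2) + ε :=
    add_nonneg (div_nonneg (by positivity) (by linarith)) hε
  have hpt : J - (expect n m fun g => ∑ b ∈ (Finset.univ : Finset (Fin k)).erase a,
      if g (x a) ∈ B ∧ g (y a) ∈ B ∧ g (x b) ∈ W then (1 : ℝ) else 0) ≤ expect n m fun g =>
      if g ∈ {g : Equiv.Perm (Pos n) | g (x a) ∈ B ∧ g (y a) ∈ B ∧ ∀ b, b ≠ a → g (x b) ∉ W}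
        then 1 else 0 := by
    rw [hJ, ← expect_sub_fun]
    refine expect_mono m fun g => ?_
    have hnn : 0 ≤ ∑ b ∈ (Finset.univ : Finset (Fin k)).erase a,
      if g (x a) ∈ B ∧ g (y a) ∈ B ∧ g (x b) ∈ W then (1 : ℝ) else 0 :=
      Finset.sum_nonneg fun _ _ => by positivity
    by_cases hg : g (x a) ∈ B ∧ g (y a) ∈ B
    · by_cases hw : ∀ b, b ≠ a → g (x b) ∉ W
      · rw [if_pos hg, if_pos (Set.mem_ofPred.mpr ⟨hg.1, hg.2, hw⟩)]
        linarith
      · push Not at hw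
        obtain ⟨b, hba, hb⟩ := hw
        have h1 := Finset.single_le_sum (f := fun b =>
          if g (x a) ∈ B ∧ g (y a) ∈ B ∧ g (x b) ∈ W then (1 : ℝ) else 0)
          (fun _ _ => by positivity) (Finset.mem_erase.mpr ⟨hba, Finset.mem_univ b⟩)
        rw [if_pos ⟨hg.1, hg.2, hb⟩] at h1
        rw [if_pos hg]
        refine le_trans (by linarith) (show (0 : ℝ) ≤ _ by positivity)
    · rw [if_neg hg]
      refine le_trans (by linarith) (show (0 : ℝ) ≤ _ by positivity)
  have hpair := h.le_expect_pair hn B ha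
  rw [← hJ] at hpair
  have hB' : (2 : ℝ) ≤ B.card := by exact_mod_cast hB
  have hJB : (B.card : ℝ) ^ 2 / (2 * (n : ℝ) ^ 4) ≤ J + ε := by
    rw [div_le_iff₀ (by positivity)]
    nlinarith [mul_nonneg (add_nonneg hJ0 hε) (sq_nonneg (n : ℝ))]
  have hfin : (B.card : ℝ) ^ 2 / (4 * (n : ℝ) ^ 4) = (B.card : ℝ) ^ 2 / (2 * (n : ℝ) ^ 4) / 2 := by
    field_simp
    norm_num
  rw [hfin]
  have := mul_le_mul_of_nonneg_right hk hpos
  linarith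

end

/-! ### The time to equilibrium for `k` cards -/

section

variable {n k : ℕ}

/-- The positions in the upper-left `b × b` square. -/
def square (n b : ℕ) : Finset (Pos n) :=
  (Finset.univ.filter fun i : Fin n => 0 ≤ i.val ∧ i.val < b) ×ˢ
    Finset.univ.filter fun i : Fin n => 0 ≤ i.val ∧ i.val < b

theorem mem_square {b : ℕ} {p : Pos n} : p ∈ square n b ↔ p.1.val < b ∧ p.2.val < b := by
  simp [square]

theorem card_square {b : ℕ} (hb : b ≤ n) : (square n b).card = b * b := by
  rw [square, Finset.card_product, card_filter_Ico_fin hb, Nat.sub_zero]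

/-- If three cards are nearly in equilibrium after `m` steps, then two `k`-tuples that differ in one
card can be made to agree one step later: with probability of order `(b / n) ^ 4` both versions of
the card, and no other card, are in a square of side `2 b`. -/
theorem Close.contracts {m : ℕ} {ε : ℝ} (h : Close n 3 m ε) (hε : 0 ≤ ε) {b : ℕ} (hb : 2 ≤ b)
    (hbn : 2 * b ≤ n) (hbk : 8 * k * (b * b) + 2 ≤ n ^ 2) {x y : Fin k ↪ Pos n} {a : Fin k}
    (hxy : ∀ b, b ≠ a → x b = y b) (ha : x a ≠ y a) :
    Contracts (1 + m) ((((b * b : ℕ) : ℝ) ^ 2 / (4 * (n : ℝ) ^ 4) - (k + 1) * ε) *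
      (b * b / (2 * (n : ℝ) ^ 2))) x y := by
  classical
  have hgood := h.le_expect_good hε (by omega) (square n b) (square n (2 * b))
    (by rw [card_square (by omega)]; nlinarith)
    (by rw [card_square hbn]; linarith) hxy ha
  rw [card_square (by omega)] at hgood
  refine Contracts.of_expect (by omega) ⟨a, hxy⟩ (by positivity) (fun g hg => ?_) hgood
  obtain ⟨h1, h2, h3⟩ := Set.mem_ofPred.mp hg
  rw [mem_square] at h1 h2
  refine contracts_one (a := a) (fun c hc => by simp [hxy c hc]) hbn hbn ?_ ?_ fun c hc => ?_
  · simp only [move_apply]; omega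
  · simp only [move_apply]; omega
  · simpa only [move_apply, mem_square] using h3 c hc

/-- The side of the square: its area is of the order of `n ^ 2 / k`. -/
theorem exists_square_side (hk : 1 ≤ k) (hkn : k < n) (hn : 81 ≤ n) :
    ∃ b, 2 ≤ b ∧ 2 * b ≤ n ∧ 8 * k * (b * b) + 2 ≤ n ^ 2 ∧ n ^ 2 ≤ 256 * k * (b * b) := by
  -- `b` is `n / (4 √k)`, rounded.
  obtain ⟨q, hq⟩ : ∃ q, q = Nat.sqrt k := ⟨_, rfl⟩
  have hq1 : q * q ≤ k := by rw [hq]; exact Nat.sqrt_le k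
  have hq2 : k < (q + 1) * (q + 1) := by rw [hq]; exact Nat.lt_succ_sqrt k
  have hq0 : 1 ≤ q := by
    rw [hq]; exact Nat.sqrt_pos.mpr hk
  have hqn : 8 * (q + 1) ≤ n := by
    by_cases h9 : q ≤ 9
    · omega
    · nlinarith
  obtain ⟨b, hb⟩ : ∃ b, b = n / (4 * (q + 1)) := ⟨_, rfl⟩
  have hb1 : 4 * (q + 1) * b ≤ n := by rw [hb]; exact Nat.mul_div_le _ _
  have hb2 : n < 4 * (q + 1) * (b + 1) := by rw [hb]; exact Nat.lt_mul_div_succ n (by omega)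
  have hb0 : 2 ≤ b := by
    rw [hb, Nat.le_div_iff_mul_le (by omega)]; omega
  have hup : n ≤ 8 * (q + 1) * b := by nlinarith
  refine ⟨b, hb0, by nlinarith, ?_, ?_⟩
  · have h1 : (4 * (q + 1) * b) * (4 * (q + 1) * b) ≤ n * n := Nat.mul_le_mul hb1 hb1
    have h2 : (k + 1) * (b * b) ≤ (q + 1) * (q + 1) * (b * b) := Nat.mul_le_mul_right _ hq2
    have h3 : 1 ≤ b * b := by nlinarith
    nlinarith
  · have h1 : n * n ≤ (8 * (q + 1) * b) * (8 * (q + 1) * b) := Nat.mul_le_mul hup hup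
    have h2 : (q + 1) * (q + 1) ≤ 4 * k := by nlinarith
    have h3 := Nat.mul_le_mul_right (b * b) h2
    nlinarith

theorem one_sub_inv_pow_le {T : ℕ} (hT : 1 ≤ T) : (1 - 1 / (T : ℝ)) ^ T ≤ 1 / 2 := by
  have hT' : (1 : ℝ) ≤ T := by exact_mod_cast hT
  have h0 : (0 : ℝ) ≤ 1 - 1 / T := by
    rw [sub_nonneg, div_le_one (by linarith)]; exact hT'
  have h1 : (2 : ℝ) ≤ (1 + 1 / (T : ℝ)) ^ T := by
    have := one_add_mul_le_pow (show (-2 : ℝ) ≤ 1 / T by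
      have : (0 : ℝ) ≤ 1 / T := by positivity
      linarith) T
    refine le_trans (le_of_eq ?_) this
    field_simp
    norm_num
  have h2 : (1 - 1 / (T : ℝ)) ^ T * (1 + 1 / (T : ℝ)) ^ T ≤ 1 := by
    rw [← mul_pow]
    refine pow_le_one₀ (by positivity) ?_
    nlinarith [sq_nonneg (1 / (T : ℝ))]
  have h3 : 0 ≤ (1 - 1 / (T : ℝ)) ^ T := pow_nonneg h0 _
  nlinarith

/-- The contraction for `k` cards: probability of order `k⁻³` within a time of order
`n log k`. -/
theorem contracts_of_close_three {C : ℕ} (h : Close n 3 (C * n) (1 / 2)) (hk : 1 ≤ k)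
    (hkn : k < n) (hn : 81 ≤ n) {x y : Fin k ↪ Pos n} (hxy : Adj x y) :
    Contracts (1 + 22 * (Nat.log 2 k + 1) * (C * n)) (1 / ((2 ^ 28 * k ^ 3 : ℕ) : ℝ)) x y := by
  obtain ⟨a, hxy⟩ := hxy
  have hk' : (1 : ℝ) ≤ k := by exact_mod_cast hk
  have hn' : (0 : ℝ) < n := by
    have : 0 < n := by omega
    exact_mod_cast this
  by_cases ha : x a = y a
  · have : x = y := by
      ext1 b
      by_cases hb : b = a
      · rw [hb, ha]
      · exact hxy b hb
    rw [this]
    refine contracts_self _ ?_ _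
    have h1 : (1 : ℝ) ≤ ((2 ^ 28 * k ^ 3 : ℕ) : ℝ) := by
      exact_mod_cast Nat.one_le_iff_ne_zero.mpr (by positivity)
    exact (div_le_one (by linarith)).mpr h1
  obtain ⟨L, hL⟩ : ∃ L, L = Nat.log 2 k + 1 := ⟨_, rfl⟩
  have hkL : k + 1 ≤ 2 ^ L := by rw [hL]; exact Nat.lt_pow_succ_log_self (by norm_num) k
  have hL1 : 1 ≤ L := by omega
  rw [← hL]
  obtain ⟨b, hb1, hb2, hb3, hb4⟩ := exists_square_side hk hkn hn
  have hε := h.pow (by omega) (by norm_num) (22 * L)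
  have key := hε.contracts (by positivity) hb1 hb2 hb3 hxy ha
  refine key.mono ?_
  have hn4 : (n : ℝ) ^ 2 ≤ 256 * k * (b * b) := by exact_mod_cast hb4
  have hb0 : (0 : ℝ) < b := by
    have : 0 < b := by omega
    exact_mod_cast this
  have e1 : 1 / (512 * (k : ℝ)) ≤ b * b / (2 * (n : ℝ) ^ 2) := by
    rw [div_le_div_iff₀ (by positivity) (by positivity)]
    linarith
  have e2 : 1 / (2 ^ 18 * (k : ℝ) ^ 2) ≤ ((b * b : ℕ) : ℝ) ^ 2 / (4 * (n : ℝ) ^ 4) := by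
    rw [div_le_div_iff₀ (by positivity) (by positivity)]
    push_cast
    have := mul_le_mul hn4 hn4 (by positivity) (by positivity)
    nlinarith
  have e3 : ((k : ℝ) + 1) * (1 / 2) ^ (22 * L) ≤ 1 / (2 ^ 19 * (k : ℝ) ^ 2) := by
    have h1 : (k : ℝ) + 1 ≤ 2 ^ L := by exact_mod_cast hkL
    have h2 : (2 : ℝ) ^ 19 ≤ 2 ^ (19 * L) := pow_le_pow_right₀ (by norm_num) (by omega)
    have h3 : (k : ℝ) ^ 2 ≤ (2 ^ L) ^ 2 := pow_le_pow_left₀ (by positivity) (by linarith) 2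
    rw [one_div_pow, mul_one_div, div_le_div_iff₀ (by positivity) (by positivity), one_mul]
    calc ((k : ℝ) + 1) * (2 ^ 19 * (k : ℝ) ^ 2) ≤ 2 ^ L * (2 ^ (19 * L) * (2 ^ L) ^ 2) := by
          gcongr
      _ = 2 ^ (22 * L) := by ring
  have e4 : 1 / (2 ^ 18 * (k : ℝ) ^ 2) = 2 * (1 / (2 ^ 19 * (k : ℝ) ^ 2)) := by
    field_simp
  calc 1 / ((2 ^ 28 * k ^ 3 : ℕ) : ℝ) = 1 / (2 ^ 19 * (k : ℝ) ^ 2) * (1 / (512 * (k : ℝ))) := by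
        push_cast
        field_simp
        norm_num
    _ ≤ _ := mul_le_mul (by linarith) e1 (by positivity) (by
        have : (0 : ℝ) ≤ 1 / (2 ^ 19 * (k : ℝ) ^ 2) := by positivity
        linarith)

/-- Repeating the contraction `O(k ^ 3 log k)` times brings the distance for one changed card below
`1 / (4 k)`, and a path of `2 k` changes joins any two tuples. -/
theorem close_of_close_three {C : ℕ} (h : Close n 3 (C * n) (1 / 2)) (hk : 1 ≤ k)
    (hkn : k < n) (hn : 81 ≤ n) :
    Close n k (2 ^ 28 * 3 * 23 * (C + 1) * (k ^ 3 * (Nat.log 2 k + 1) ^ 2 * n)) (1 / 2) := by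
  obtain ⟨L, hL⟩ : ∃ L, L = Nat.log 2 k + 1 := ⟨_, rfl⟩
  have hkL : k + 1 ≤ 2 ^ L := by rw [hL]; exact Nat.lt_pow_succ_log_self (by norm_num) k
  have hL1 : 1 ≤ L := by omega
  obtain ⟨T, hT⟩ : ∃ T, T = 2 ^ 28 * k ^ 3 := ⟨_, rfl⟩
  have hT1 : 1 ≤ T := by
    rw [hT]; exact Nat.one_le_iff_ne_zero.mpr (by positivity)
  have hT1' : (1 : ℝ) ≤ T := by exact_mod_cast hT1
  have hC : ∀ x y : Fin k ↪ Pos n, Adj x y →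
      Contracts (1 + 22 * L * (C * n)) (1 / (T : ℝ)) x y := fun x y hxy => by
    rw [hT, hL]
    exact contracts_of_close_three h hk hkn hn hxy
  have hadj := AdjBound.pow (by omega) ((div_le_one (by linarith)).mpr hT1') hC (T * (3 * L))
  intro x y
  have hw := hadj.within (by nlinarith) x y
  refine (hw.le (by omega) ?_).mono ?_
  · rw [← hL]
    have h1 : 1 + 22 * L * (C * n) ≤ 23 * (C + 1) * (L * n) := by
      have : 1 ≤ L * n := Nat.one_le_iff_ne_zero.mpr (by
        have : n ≠ 0 := by omega
        positivity)
      nlinarith [Nat.zero_le (C * (L * n))]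
    calc T * (3 * L) * (1 + 22 * L * (C * n)) ≤ T * (3 * L) * (23 * (C + 1) * (L * n)) :=
          Nat.mul_le_mul_left _ h1
      _ = _ := by rw [hT]; ring
  · have h1 : (1 - 1 / (T : ℝ)) ^ (T * (3 * L)) ≤ (1 / 2) ^ (3 * L) := by
      rw [pow_mul]
      exact pow_le_pow_left₀ (pow_nonneg (by
        rw [sub_nonneg]; exact (div_le_one (by linarith)).mpr hT1') _) (one_sub_inv_pow_le hT1) _
    have h2 : (k : ℝ) ≤ 2 ^ L := by
      have : k ≤ 2 ^ L := by omega
      exact_mod_cast this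
    have h3 : (4 : ℝ) ≤ (2 ^ L) ^ 2 := by
      have h4 : (2 : ℝ) ≤ 2 ^ L := by
        calc (2 : ℝ) = 2 ^ 1 := by norm_num
          _ ≤ 2 ^ L := pow_le_pow_right₀ (by norm_num) hL1
      nlinarith
    have h5 : 2 * (k : ℝ) * (1 / 2) ^ (3 * L) ≤ 1 / 2 := by
      rw [one_div_pow, mul_one_div, div_le_div_iff₀ (by positivity) (by norm_num), one_mul]
      calc 2 * (k : ℝ) * 2 = 4 * k := by ring
        _ ≤ (2 ^ L) ^ 2 * 2 ^ L := mul_le_mul h3 h2 (by positivity) (by positivity)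
        _ = 2 ^ (3 * L) := by ring
    have h6 : (0 : ℝ) ≤ 2 * k := by positivity
    exact (mul_le_mul_of_nonneg_left h1 h6).trans h5

/-- The time to bring `k` cards close to equilibrium. The finitely many small `n` are covered by
enlarging the constant. -/
theorem exists_close_half_all : ∃ C : ℕ, 1 ≤ C ∧ ∀ n k, 1 ≤ k → k < n →
    Close n k (C * (k ^ 3 * (Nat.log 2 k + 1) ^ 2 * n)) (1 / 2) := by
  obtain ⟨C, N, hC⟩ := exists_close_three
  have hM : ∀ n, ∃ M, 0 < n → ∀ k, Close n k M (1 / 2) := by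
    intro n
    rcases Nat.eq_zero_or_pos n with rfl | hn
    · exact ⟨0, by simp⟩
    · obtain ⟨M, hM⟩ := exists_close_half hn
      exact ⟨M, fun _ => hM⟩
  choose M hM using hM
  let S := ∑ n ∈ Finset.range (N + 81), M n
  refine ⟨2 ^ 28 * 3 * 23 * (C + 1) + S, by omega, fun n k hk hkn => ?_⟩
  have hpos : 1 ≤ k ^ 3 * (Nat.log 2 k + 1) ^ 2 * n := Nat.one_le_iff_ne_zero.mpr (by
    have : n ≠ 0 := by omega
    positivity)
  by_cases hn : N + 81 ≤ n
  · refine (close_of_close_three (hC n (by omega)) hk hkn (by omega)).le (by omega) ?_ le_rfl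
    exact Nat.mul_le_mul_right _ (by omega)
  · refine (hM n (by omega) k).le (by omega) ?_ le_rfl
    have h1 : M n ≤ S := Finset.single_le_sum (fun _ _ => Nat.zero_le _)
      (Finset.mem_range.mpr (by omega))
    calc M n ≤ (2 ^ 28 * 3 * 23 * (C + 1) + S) * 1 := by omega
      _ ≤ _ := Nat.mul_le_mul_left _ hpos

end

section

variable {n k : ℕ}

/-! ### Continuous time -/

/-- The Poisson weights. -/
def poisson (t : ℝ) (m : ℕ) : ℝ := Real.exp (-t) * (t ^ m / (m ! : ℝ))

theorem poisson_nonneg {t : ℝ} (ht : 0 ≤ t) (m : ℕ) : 0 ≤ poisson t m := by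
  unfold poisson; positivity

theorem hasSum_poisson_mul_pow (t r : ℝ) :
    HasSum (fun m => poisson t m * r ^ m) (Real.exp (-(t * (1 - r)))) := by
  have h := (NormedSpace.expSeries_div_hasSum_exp (t * r)).mul_left (Real.exp (-t))
  rw [← Real.exp_eq_exp_ℝ, ← Real.exp_add] at h
  have e : (fun m => poisson t m * r ^ m) =
      fun m : ℕ => Real.exp (-t) * ((t * r) ^ m / (m ! : ℝ)) := by
    funext m
    rw [poisson, mul_pow]
    ring
  rw [e, show -(t * (1 - r)) = -t + t * r by ring]
  exact h

theorem hasSum_poisson (t : ℝ) : HasSum (poisson t) 1 := by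
  simpa using hasSum_poisson_mul_pow t 1

theorem summable_poisson_mul {t : ℝ} (ht : 0 ≤ t) {u : ℕ → ℝ} (h0 : ∀ m, 0 ≤ u m)
    (h1 : ∀ m, u m ≤ 1) : Summable fun m => poisson t m * u m :=
  (hasSum_poisson t).summable.of_nonneg_of_le (fun m => mul_nonneg (poisson_nonneg ht m) (h0 m))
    fun m => mul_le_of_le_one_right (poisson_nonneg ht m) (h1 m)

open Classical in
theorem mass_eq_sum (R : Equiv.Perm (Pos n) → ℝ) (x : Fin k ↪ Pos n) (B : Set (Fin k ↪ Pos n)) :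
    mass R (cardEvent x B) = ∑ g, R g * if move g x ∈ B then 1 else 0 := by
  refine Finset.sum_congr rfl fun g _ => ?_
  rw [mul_ite, mul_one, mul_zero]
  rfl

theorem convPow_le_one (hn : 0 < n) (m : ℕ) (g : Equiv.Perm (Pos n)) :
    convPow (step n) m g ≤ 1 := by
  rw [← expect_const hn m (1 : ℝ)]
  simp only [expect, mul_one]
  exact Finset.single_le_sum (fun g _ => convPow_nonneg m g) (Finset.mem_univ g)

open Classical in
theorem hasSum_mass_shuffleAt (hn : 0 < n) {t : ℝ} (ht : 0 ≤ t) (x : Fin k ↪ Pos n)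
    (B : Set (Fin k ↪ Pos n)) :
    HasSum (fun m => poisson t m * expect n m fun g => if move g x ∈ B then 1 else 0)
      (mass (shuffleAt n t) (cardEvent x B)) := by
  have h1 : ∀ g : Equiv.Perm (Pos n), HasSum
      (fun m => poisson t m * convPow (step n) m g * if move g x ∈ B then 1 else 0)
      (shuffleAt n t g * if move g x ∈ B then 1 else 0) := fun g =>
    (summable_poisson_mul ht (fun m => convPow_nonneg m g)
      fun m => convPow_le_one hn m g).hasSum.mul_right _
  have h2 := hasSum_sum (s := Finset.univ) fun g _ => h1 g
  rw [mass_eq_sum]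
  convert h2 using 1
  funext m
  simp only [expect, Finset.mul_sum, mul_assoc]

open Classical in
/-- The uniform distribution is invariant, so the mass of an event under it is the mean over all
starting tuples of its probability after `m` steps. -/
theorem mass_uniform_eq (hn : 0 < n) (m : ℕ) (x : Fin k ↪ Pos n) (B : Set (Fin k ↪ Pos n)) :
    mass (uniform n) (cardEvent x B) = 1 / (Fintype.card (Equiv.Perm (Pos n)) : ℝ) *
      ∑ h : Equiv.Perm (Pos n), expect n m fun g => if move g (move h x) ∈ B then 1 else 0 := by
  rw [mass_eq_sum, ← expect_sum]
  have h1 : ∀ g : Equiv.Perm (Pos n),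
      ∑ h : Equiv.Perm (Pos n), (if move g (move h x) ∈ B then (1 : ℝ) else 0) =
        ∑ h : Equiv.Perm (Pos n), if move h x ∈ B then (1 : ℝ) else 0 := fun g =>
    Equiv.sum_comp (Equiv.mulLeft g) fun h => if move h x ∈ B then (1 : ℝ) else 0
  simp only [h1]
  rw [expect_const hn]
  simp only [uniform, Finset.mul_sum]

open Classical in
theorem Close.expect_sub_mass_uniform_le (hn : 0 < n) {m : ℕ} {d : ℝ} (h : Close n k m d)
    (x : Fin k ↪ Pos n) (B : Set (Fin k ↪ Pos n)) :
    (expect n m fun g => if move g x ∈ B then (1 : ℝ) else 0) -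
      mass (uniform n) (cardEvent x B) ≤ d := by
  have hcard : (0 : ℝ) < Fintype.card (Equiv.Perm (Pos n)) := by
    exact_mod_cast Fintype.card_pos
  rw [mass_uniform_eq hn m, sub_le_iff_le_add, ← sub_le_iff_le_add', one_div,
    le_inv_mul_iff₀ hcard]
  have h1 := Finset.card_nsmul_le_sum Finset.univ
    (fun h : Equiv.Perm (Pos n) => expect n m fun g => if move g (move h x) ∈ B then (1 : ℝ) else 0)
    ((expect n m fun g => if move g x ∈ B then (1 : ℝ) else 0) - d) fun h' _ => by
      have := h x (move h' x) (fun z => if z ∈ B then 1 else 0) (fun z => by positivity)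
        (fun z => by split_ifs <;> norm_num)
      linarith
  rwa [Finset.card_univ, nsmul_eq_mul] at h1

theorem half_pow_div_le {M : ℕ} (hM : 0 < M) (m : ℕ) :
    (1 / 2 : ℝ) ^ (m / M) ≤ 2 * (1 - 1 / (2 * (M : ℝ))) ^ m := by
  have hM' : (1 : ℝ) ≤ M := by exact_mod_cast hM
  set r : ℝ := 1 - 1 / (2 * (M : ℝ)) with hr
  have hx1 : 1 / (2 * (M : ℝ)) ≤ 1 / 2 := by
    rw [div_le_div_iff₀ (by positivity) (by norm_num)]
    linarith
  have hx0 : 0 ≤ 1 / (2 * (M : ℝ)) := by positivity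
  have hr0 : 0 ≤ r := by linarith
  have hrM : 1 / 2 ≤ r ^ M := by
    have := one_add_mul_le_pow (show (-2 : ℝ) ≤ -(1 / (2 * (M : ℝ))) by linarith) M
    rw [hr, sub_eq_add_neg]
    refine le_trans (le_of_eq ?_) this
    field_simp
    norm_num
  have hmod : 1 / 2 ≤ r ^ (m % M) :=
    hrM.trans (pow_le_pow_of_le_one hr0 (by linarith) (Nat.mod_lt m hM).le)
  calc (1 / 2 : ℝ) ^ (m / M) ≤ (r ^ M) ^ (m / M) := pow_le_pow_left₀ (by norm_num) hrM _
    _ ≤ (r ^ M) ^ (m / M) * (2 * r ^ (m % M)) :=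
        le_mul_of_one_le_right (by positivity) (by linarith)
    _ = 2 * r ^ m := by
        rw [← pow_mul, mul_left_comm, ← pow_add, Nat.div_add_mod]

/-- If `M` steps halve the distance between all pairs of tuples, then in continuous time the
distance to uniformity decays like `exp (-t / (2 M))`. -/
theorem Close.mass_sub_mass_le (hn : 0 < n) {M : ℕ} (hM : 0 < M) (h : Close n k M (1 / 2))
    {t : ℝ} (ht : 0 ≤ t) (x : Fin k ↪ Pos n) (B : Set (Fin k ↪ Pos n)) :
    mass (shuffleAt n t) (cardEvent x B) - mass (uniform n) (cardEvent x B) ≤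
      2 * Real.exp (-(t / (2 * M))) := by
  classical
  have h1 := (hasSum_mass_shuffleAt hn ht x B).sub
    ((hasSum_poisson t).mul_right (mass (uniform n) (cardEvent x B)))
  rw [one_mul] at h1
  have h2 := (hasSum_poisson_mul_pow t (1 - 1 / (2 * (M : ℝ)))).mul_left 2
  rw [sub_sub_cancel, mul_one_div] at h2
  refine hasSum_le (fun m => ?_) h1 h2
  have hm := ((h.pow hn (by norm_num) (m / M)).le hn (Nat.div_mul_le_self m M)
    (half_pow_div_le hM m)).expect_sub_mass_uniform_le hn x B
  rw [← mul_sub, mul_left_comm]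
  exact mul_le_mul_of_nonneg_left hm (poisson_nonneg ht m)

theorem mass_shuffleAt_le_one (hn : 0 < n) {t : ℝ} (ht : 0 ≤ t) (x : Fin k ↪ Pos n)
    (B : Set (Fin k ↪ Pos n)) : mass (shuffleAt n t) (cardEvent x B) ≤ 1 := by
  classical
  refine hasSum_le (fun m => ?_) (hasSum_mass_shuffleAt hn ht x B) (hasSum_poisson t)
  refine mul_le_of_le_one_right (poisson_nonneg ht m) (expect_le_const hn m fun g => ?_)
  split_ifs <;> norm_num

/-- The difference of the masses is never equal to one, since an event of uniform mass zero is
empty. -/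
theorem mass_sub_mass_lt_one (hn : 0 < n) {t : ℝ} (ht : 0 ≤ t) (x : Fin k ↪ Pos n)
    (B : Set (Fin k ↪ Pos n)) :
    mass (shuffleAt n t) (cardEvent x B) - mass (uniform n) (cardEvent x B) < 1 := by
  classical
  have hcard : (0 : ℝ) < Fintype.card (Equiv.Perm (Pos n)) := by
    exact_mod_cast Fintype.card_pos
  have h1 := mass_shuffleAt_le_one hn ht x B
  by_cases hB : ∃ g : Equiv.Perm (Pos n), move g x ∈ B
  · obtain ⟨g, hg⟩ := hB
    have h2 : 0 < mass (uniform n) (cardEvent x B) := by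
      rw [mass_eq_sum]
      refine Finset.sum_pos' (fun g _ => ?_) ⟨g, Finset.mem_univ g, ?_⟩
      · unfold uniform; positivity
      · rw [if_pos hg]; unfold uniform; positivity
    linarith
  · push Not at hB
    rw [mass_eq_sum, mass_eq_sum]
    simp [hB]

theorem Close.kSetDist_lt (hn : 0 < n) {M : ℕ} (hM : 0 < M) (h : Close n k M (1 / 2))
    {j : ℕ} {t : ℝ} (ht : 8 * (M : ℝ) * j < t) : kSetDist n k (shuffleAt n t) < 1 / 2 ^ j := by
  have ht0 : 0 ≤ t := le_trans (by positivity) ht.le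
  have hM' : (0 : ℝ) < M := by exact_mod_cast hM
  have key : ∀ p : (Fin k ↪ Pos n) × Set (Fin k ↪ Pos n), mass (shuffleAt n t) (cardEvent p.1 p.2) -
      mass (uniform n) (cardEvent p.1 p.2) < 1 / 2 ^ j := by
    rintro ⟨x, B⟩
    rcases Nat.eq_zero_or_pos j with rfl | hj
    · simpa using mass_sub_mass_lt_one hn ht0 x B
    refine (h.mass_sub_mass_le hn hM ht0 x B).trans_lt ?_
    have h1 : Real.exp (-(t / (2 * M))) < Real.exp (-(4 * j)) := by
      rw [Real.exp_lt_exp, neg_lt_neg_iff, lt_div_iff₀ (by positivity)]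
      linarith
    have h2 : Real.exp (-(4 * (j : ℝ))) ≤ (1 / 2) ^ (4 * j) := by
      have h3 : Real.exp (-1) ≤ 1 / 2 := by
        rw [Real.exp_neg, one_div]
        exact inv_anti₀ (by norm_num) (by linarith [Real.add_one_le_exp (1 : ℝ)])
      calc Real.exp (-(4 * (j : ℝ))) = Real.exp (-1) ^ (4 * j) := by
            rw [← Real.exp_nat_mul]; push_cast; ring_nf
        _ ≤ _ := pow_le_pow_left₀ (Real.exp_pos _).le h3 _
    have h4 : 2 * (1 / 2 : ℝ) ^ (4 * j) ≤ 1 / 2 ^ j := by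
      calc 2 * (1 / 2 : ℝ) ^ (4 * j) ≤ 2 * (1 / 2) ^ (j + 1) :=
            mul_le_mul_of_nonneg_left
              (pow_le_pow_of_le_one (by norm_num) (by norm_num) (by omega)) (by norm_num)
        _ = 1 / 2 ^ j := by rw [pow_succ, one_div_pow]; ring
    linarith
  rcases isEmpty_or_nonempty ((Fin k ↪ Pos n) × Set (Fin k ↪ Pos n)) with hE | hE
  · rw [kSetDist, Real.iSup_of_isEmpty]
    positivity
  · obtain ⟨p, hp⟩ := exists_eq_ciSup_of_finite (f := fun p : (Fin k ↪ Pos n) ×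
      Set (Fin k ↪ Pos n) => mass (shuffleAt n t) (cardEvent p.1 p.2) -
        mass (uniform n) (cardEvent p.1 p.2))
    rw [kSetDist, ← hp]
    exact key p

theorem log_two_add_one_le (hk : 2 ≤ k) : ((Nat.log 2 k + 1 : ℕ) : ℝ) ≤ 4 * Real.log k := by
  have hk' : (2 : ℝ) ≤ k := by exact_mod_cast hk
  have h2 : (1 / 2 : ℝ) ≤ Real.log 2 := by linarith [Real.log_two_gt_d9]
  have h3 : Real.log 2 ≤ Real.log k := Real.log_le_log (by norm_num) hk'
  have h4 : (Nat.log 2 k : ℝ) * Real.log 2 ≤ Real.log k := by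
    rw [← Real.log_pow]
    refine Real.log_le_log (by positivity) ?_
    exact_mod_cast Nat.pow_log_le_self 2 (by omega)
  have h5 : (Nat.log 2 k : ℝ) * (1 / 2) ≤ Nat.log 2 k * Real.log 2 :=
    mul_le_mul_of_nonneg_left h2 (Nat.cast_nonneg _)
  push_cast
  linarith

end

end ArrayShuffle

end

theorem theorem1 :
    (∃ c : ℝ, 0 < c ∧ ∀ n k : ℕ, 1 < k → k < n → ∀ (j : ℕ) (t : ℝ),
      c * (k : ℝ) ^ 3 * Real.log (k : ℝ) ^ 2 * (n : ℝ) * (j : ℝ) < t →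
        ArrayShuffle.kSetDist n k (ArrayShuffle.shuffleAt n t) < 1 / 2 ^ j) ∧
    (∀ k : ℕ, 1 ≤ k → ∃ C : ℝ, 0 < C ∧ ∀ n : ℕ, k < n → ∀ (j : ℕ) (t : ℝ),
      C * (n : ℝ) * (j : ℝ) < t →
        ArrayShuffle.kSetDist n k (ArrayShuffle.shuffleAt n t) < 1 / 2 ^ j) := by
  obtain ⟨C, hC1, hC⟩ := ArrayShuffle.exists_close_half_all
  have hC0 : (0 : ℝ) < C := by exact_mod_cast hC1
  have hM : ∀ n k : ℕ, 1 ≤ k → k < n → 0 < C * (k ^ 3 * (Nat.log 2 k + 1) ^ 2 * n) := by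
    intro n k hk hkn
    have : 0 < n := by omega
    positivity
  refine ⟨⟨128 * C, by positivity, fun n k hk hkn j t ht => ?_⟩, fun k hk =>
    ⟨8 * (C * (k ^ 3 * ((Nat.log 2 k + 1 : ℕ) : ℝ) ^ 2)), ?_, fun n hkn j t ht => ?_⟩⟩
  · refine (hC n k hk.le hkn).kSetDist_lt (by omega) (hM n k hk.le hkn) (lt_of_le_of_lt ?_ ht)
    have hl := pow_le_pow_left₀ (Nat.cast_nonneg _) (ArrayShuffle.log_two_add_one_le hk) 2
    have h0 : (0 : ℝ) ≤ 8 * C * k ^ 3 * n * j := by positivity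
    have := mul_le_mul_of_nonneg_left hl h0
    push_cast at this ⊢
    linarith
  · have : (0 : ℝ) < k := by exact_mod_cast hk
    positivity
  · refine (hC n k hk hkn).kSetDist_lt (by omega) (hM n k hk hkn) (lt_of_le_of_lt (le_of_eq ?_) ht)
    push_cast
    ring
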